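/- Let $\varphi\colon\mathbb R^n\to(-\infty,\infty]$ be \emph{fully subamenable} at $\bar x$ with $\varphi(\bar x)<\infty$; that is, for some $m$ there are $f\colon\mathbb R^n\to\mathbb R^m$ and $\vartheta\colon\mathbb R^m\to(-\infty,\infty]$ such that (a) $\varphi=\vartheta\circ f$ on a neighborhood of $\bar x$; (b) $f$ is twice differentiable at $\bar x$, i.e. $f$ is differentiable around $\bar x$ and $\nabla f$ is differentiable at $\bar x$; (c) $\vartheta$ is convex and piecewise linear-quadratic, i.e. $\operatorname{dom}\vartheta:=\{y\mid\vartheta(y)<\infty\}$ is a union of finitely many polyhedral convex sets $\Omega_i$ with $\vartheta(y)=\tfrac12\langle A_iy,y\rangle+\langle a_i,y\rangle+\alpha_i$ for $y\in\Omega_i$, where the matrices $A_i$ are symmetric; (d) the metric subregularity qualification condition holds: for some $\kappa\ge0$ and all $x$ near $\bar x$, $$\operatorname{dist}\big(x;\{u\mid f(u)\in\operatorname{dom}\vartheta\}\big)\le\kappa\,\operatorname{dist}\big(f(x);\operatorname{dom}\vartheta\big).$$ Write $\partial$ for the limiting subdifferential: $v\in\partial\varphi(\bar x)$ iff $(v,-1)$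 is a limiting (Mordukhovich) normal to $\operatorname{epi}\varphi$ at $(\bar x,\varphi(\bar x))$. Put $$\Delta_t^2\varphi(\bar x,\bar v)(w):=\frac{\varphi(\bar x+tw)-\varphi(\bar x)-t\langle\bar v,w\rangle}{\frac12t^2}\quad(t>0),\qquad \mathrm d^2\varphi(\bar x,\bar v)(w):=\liminf_{t\downarrow0,\;u\to w}\Delta_t^2\varphi(\bar x,\bar v)(u),$$ and likewise for $\vartheta$. Then for every $\bar v\in\partial\varphi(\bar x)$ the function $\varphi$ is properly twice epi-differentiable at $\bar x$ for $\bar v$: the functions $\Delta_t^2\varphi(\bar x,\bar v)$ epi-converge to $\mathrm d^2\varphi(\bar x,\bar v)$ as $t\downarrow0$, and $\mathrm d^2\varphi(\bar x,\bar v)$ is proper (it never takes the value $-\infty$ and is not identically $\infty$). Moreover, for every such representation $\varphi=\vartheta\circ f$, every $\bar v\in\partial\varphi(\bar x)$ and every $w\in\mathbb R^n$, $$\mathrm d^2\varphi(\bar x,\bar v)(w)=\max_{\lambda\in\Lambda(\bar x,\bar v)}\Big\{\mathrm d^2\vartheta\big(f(\bar x),\lambda\big)\big(\nabla f(\bar x)w\big)+\big\langle\lambda,\nabla^2f(\bar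 x)(w,w)\big\rangle\Big\},$$ where $\Lambda(\bar x,\bar v):=\{\lambda\in\partial\vartheta(f(\bar x))\mid\nabla f(\bar x)^*\lambda=\bar v\}$ and the maximum is taken in $[-\infty,\infty]$ and is attained (its value may be $\infty$). -/

import Mathlib

open Filter Topology
open scoped RealInnerProductSpace NNReal

noncomputable section

namespace VarAnalysis

/-! ### Extended-real-valued functions, tangency and subgradients -/

section General

variable {E F : Type*} [NormedAddCommGroup E] [InnerProductSpace ℝ E]
  [NormedAddCommGroup F] [InnerProductSpace ℝ F]

/-- The effective domain `{x | φ x < ∞}`. -/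
def effDom (φ : E → EReal) : Set E := {x | φ x < ⊤}

/-- The epigraph of `φ`, as a subset of `E × ℝ` with the Euclidean (`ℓ²`) product structure. -/
def epigraph (φ : E → EReal) : Set (WithLp 2 (E × ℝ)) := {p | φ p.fst ≤ (p.snd : EReal)}

/-- The regular (Fréchet) normal cone:
`limsup ⟪v, y - x⟫ / ‖y - x‖ ≤ 0` as `y → x` within `Ω`. -/
def regularNormalCone (Ω : Set E) (x : E) : Set E :=
  {v | x ∈ Ω ∧ ∀ ε > (0 : ℝ), ∀ᶠ y in 𝓝[Ω] x, ⟪v, y - x⟫ ≤ ε * ‖y - x‖}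

/-- The limiting (Mordukhovich) normal cone. -/
def limitingNormalCone (Ω : Set E) (x : E) : Set E :=
  {v | x ∈ Ω ∧ ∃ (xs vs : ℕ → E), (∀ k, xs k ∈ Ω) ∧ Tendsto xs atTop (𝓝 x) ∧
    (∀ k, vs k ∈ regularNormalCone Ω (xs k)) ∧ Tendsto vs atTop (𝓝 v)}

/-- The limiting subdifferential of `φ` at a point where `φ` is finite (and `∅` elsewhere):
those `v` with `(v, -1)` a limiting normal to the epigraph at `(x, φ x)`. -/
def limitingSubdiff (φ : E → EReal) (x : E) : Set E :=
  {v | φ x ≠ ⊤ ∧ φ x ≠ ⊥ ∧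
    WithLp.toLp 2 (v, (-1 : ℝ)) ∈
      limitingNormalCone (epigraph φ) (WithLp.toLp 2 (x, (φ x).toReal))}

/-! ### Second subderivatives and twice epi-differentiability -/

/-- The second-order difference quotient
`(φ (x + t w) - φ x - t ⟪v, w⟫) / (t² / 2)`, meaningful for `t > 0` and `φ x` finite. -/
def secondQuot (φ : E → EReal) (x v : E) (t : ℝ) (w : E) : EReal :=
  (φ (x + t • w) - φ x - ((t * ⟪v, w⟫ : ℝ) : EReal)) / ((t ^ 2 / 2 : ℝ) : EReal)

/-- The second subderivative: the lower limit of the second-order difference quotients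
as `t ↓ 0` and `u → w`. -/
def secondSubderiv (φ : E → EReal) (x v w : E) : EReal :=
  liminf (fun p : ℝ × E => secondQuot φ x v p.1 p.2) (𝓝[>] (0 : ℝ) ×ˢ 𝓝 w)

/-- Epi-convergence of the family `g t` to `h` as `t ↓ 0`: along every sequence `t k ↓ 0`,
`liminf g (t k) (w k) ≥ h w` for every `w k → w`, and `limsup g (t k) (w k) ≤ h w`
for some `w k → w`. -/
def EpiConverges (g : ℝ → E → EReal) (h : E → EReal) : Prop :=
  ∀ t : ℕ → ℝ, (∀ k, 0 < t k) → Tendsto t atTop (𝓝 0) → ∀ w : E,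
    (∀ ws : ℕ → E, Tendsto ws atTop (𝓝 w) →
      h w ≤ liminf (fun k => g (t k) (ws k)) atTop) ∧
    ∃ ws : ℕ → E, Tendsto ws atTop (𝓝 w) ∧
      limsup (fun k => g (t k) (ws k)) atTop ≤ h w

/-- `φ` is twice epi-differentiable at `x` for `v`. -/
def TwiceEpiDifferentiableAt (φ : E → EReal) (x v : E) : Prop :=
  EpiConverges (secondQuot φ x v) (secondSubderiv φ x v)

/-- A proper extended-real-valued function: never `-∞`, and not identically `∞`. -/
def IsProperFun (h : E → EReal) : Prop :=
  (∀ w, h w ≠ ⊥) ∧ (effDom h).Nonempty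

/-- `φ` is properly twice epi-differentiable at `x` for `v`. -/
def ProperlyTwiceEpiDifferentiableAt (φ : E → EReal) (x v : E) : Prop :=
  TwiceEpiDifferentiableAt φ x v ∧ IsProperFun (secondSubderiv φ x v)

/-! ### Piecewise linear-quadratic functions -/

/-- A polyhedral convex set: the intersection of finitely many closed half-spaces. -/
def IsPolyhedralSet (Ω : Set E) : Prop :=
  ∃ (k : ℕ) (a : Fin k → E) (b : Fin k → ℝ), Ω = {x | ∀ i, ⟪a i, x⟫ ≤ b i}

/-- A piecewise linear-quadratic function: its domain is a finite union of polyhedral convex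
sets, on each of which it has the form `½ ⟪A x, x⟫ + ⟪a, x⟫ + α` with `A` symmetric. -/
def IsPWLQ (ϑ : E → EReal) : Prop :=
  ∃ (s : ℕ) (Ω : Fin s → Set E) (A : Fin s → E →ₗ[ℝ] E) (a : Fin s → E) (α : Fin s → ℝ),
    (∀ i, IsPolyhedralSet (Ω i)) ∧ (∀ i, (A i).IsSymmetric) ∧ effDom ϑ = ⋃ i, Ω i ∧
    ∀ i, ∀ x ∈ Ω i, ϑ x = ((1 / 2 * ⟪A i x, x⟫ + ⟪a i, x⟫ + α i : ℝ) : EReal)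

/-- Convexity of an extended-real-valued function, through its epigraph. -/
def IsConvexFun (ϑ : E → EReal) : Prop := Convex ℝ (epigraph ϑ)

/-! ### Metric subregularity and fully subamenable functions -/

/-- Metric subregularity of the set-valued mapping `G` at `(x, y) ∈ gph G`:
`dist (u; G⁻¹ y) ≤ κ dist (y; G u)` for all `u` near `x`, with some `κ ≥ 0`. -/
def MetricallySubregularAt (G : E → Set F) (x : E) (y : F) : Prop :=
  y ∈ G x ∧ ∃ κ : ℝ≥0, ∀ᶠ u in 𝓝 x,
    Metric.infEDist u {u' | y ∈ G u'} ≤ κ * Metric.infEDist y (G u)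

/-- The metric subregularity qualification condition for `ϑ ∘ f` at `x`: the mapping
`u ↦ f u - dom ϑ` is metrically subregular at `(x, 0)`. -/
def MSQC (ϑ : F → EReal) (f : E → F) (x : E) : Prop :=
  MetricallySubregularAt (fun u => {z : F | ∃ y ∈ effDom ϑ, z = f u - y}) x 0

/-- `f` is twice differentiable at `x`: it is differentiable around `x` and its derivative is
differentiable at `x`. -/
def TwiceDifferentiableAt (f : E → F) (x : E) : Prop :=
  (∀ᶠ u in 𝓝 x, DifferentiableAt ℝ f u) ∧ DifferentiableAt ℝ (fderiv ℝ f) x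

/-- The second derivative `∇²f(x)(w, u)`. -/
def secondDeriv (f : E → F) (x w u : E) : F := fderiv ℝ (fderiv ℝ f) x w u

/-- `φ = ϑ ∘ f` around `x ∈ dom φ` is a fully subamenable representation of `φ` at `x`. -/
structure IsFullySubamenableRep (φ : E → EReal) (x : E) (f : E → F) (ϑ : F → EReal) :
    Prop where
  mem_dom : x ∈ effDom φ
  eq_comp : ∀ᶠ u in 𝓝 x, φ u = ϑ (f u)
  twiceDiff : TwiceDifferentiableAt f x
  isConvex : IsConvexFun ϑ
  isPWLQ : IsPWLQ ϑ
  msqc : MSQC ϑ f x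

/-- The multiplier set `{λ ∈ ∂ϑ(f x) | ∇f(x)^* λ = v}`. -/
def multiplierSet [CompleteSpace E] [CompleteSpace F]
    (f : E → F) (ϑ : F → EReal) (x v : E) : Set F :=
  {l | ContinuousLinearMap.adjoint (fderiv ℝ f x) l = v ∧ l ∈ limitingSubdiff ϑ (f x)}

/-- `φ` is fully subamenable at `x`. -/
def FullySubamenableAt (φ : E → EReal) (x : E) : Prop :=
  ∃ (m : ℕ) (f : E → EuclideanSpace ℝ (Fin m)) (ϑ : EuclideanSpace ℝ (Fin m) → EReal),
    IsFullySubamenableRep φ x f ϑ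

end General

end VarAnalysis

end

/-! Write `y = f x`, `A = ∇f(x)`, `u = A w`, `q = ∇²f(x)(w, w)`.

Lower bound. If `A* l = v`, the difference quotient of `φ` at `w'` equals that of `ϑ` at `y` for
`l`, in a direction tending to `u`, plus `⟪l, ·⟫` of a Taylor quotient tending to `q`. Hence `d²ϑ(y,
l)(u) + ⟪l, q⟫ ≤ d²φ(x, v)(w)` for each such `l` (`secondSubderiv_comp_ge`).

Upper bound. The qualification condition, with `ϑ` Lipschitz on its domain, acts as an exact
penalty: an approximate solution of `f u = p`, `p ∈ dom ϑ`, is corrected at a cost linear in the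
residual (`exists_correction`). If `d²ϑ(y, l₀)(u)` is finite for one multiplier `l₀`, the polyhedral
pieces give `ϑ (y + t u) = θ + t ⟪v, w⟫ + t² c / 2` exactly for small `t > 0`. Along arcs `x + t w +
t² z / 2` the quotients of `φ` are then bounded, up to arbitrarily small errors, by `R - ⟪v, z⟫ + L
‖A z + q - h‖`, for every `z` and every `(h, R)` in the convex parabolic epigraph of `ϑ`. Let `G` be
the infimum of these bounds; it is finite by the lower bound for `l₀`. Separation
(`exists_multiplier_of_le_penalty`) dualizes `G` into a multiplier `l` with `G ≤ c + ⟪l, q⟫`. Since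
`c` depends only on the values of `ϑ` on the ray, `c ≤ d²ϑ(y, l)(u)`. So `d²φ ≤ G ≤ d²ϑ(y, l)(u) +
⟪l, q⟫ ≤ d²φ`: the maximum is attained at `l`, and arcs nearly realizing `G` give recovery
sequences.

An initial multiplier `l₀` comes from the same penalty and separation argument to first order, at
nearby points carrying regular normals; the penalty constant bounds these multipliers and
compactness gives a limit. -/

namespace VarAnalysis

/-! ### Convexity, Taylor expansion and separation -/

section Basics

variable {E F : Type*} [NormedAddCommGroup E] [InnerProductSpace ℝ E]
  [NormedAddCommGroup F] [InnerProductSpace ℝ F]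

lemma IsConvexFun.combo {ϑ : F → EReal} (h : IsConvexFun ϑ) {p q : F} {r s : ℝ}
    (hp : ϑ p ≤ r) (hq : ϑ q ≤ s) {a b : ℝ} (ha : 0 ≤ a) (hb : 0 ≤ b) (hab : a + b = 1) :
    ϑ (a • p + b • q) ≤ ((a * r + b * s : ℝ) : EReal) := by
  have h1 : WithLp.toLp 2 (p, r) ∈ epigraph ϑ := hp
  have h2 : WithLp.toLp 2 (q, s) ∈ epigraph ϑ := hq
  exact h h1 h2 ha hb hab

lemma IsPolyhedralSet.isClosed {Ω : Set E} (h : IsPolyhedralSet Ω) : IsClosed Ω := by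
  obtain ⟨k, a, b, rfl⟩ := h
  simp only [Set.ofPred_forall]
  exact isClosed_iInter fun i => isClosed_le (by fun_prop) continuous_const

lemma IsPolyhedralSet.convex {Ω : Set E} (h : IsPolyhedralSet Ω) : Convex ℝ Ω := by
  obtain ⟨k, a, b, rfl⟩ := h
  simp only [Set.ofPred_forall]
  refine convex_iInter fun i => ?_
  exact convex_halfSpace_le (innerSL ℝ (a i)).toLinearMap.isLinear (b i)

/-- Clearing denominators is legitimate because `φ x` is finite and `t > 0`; real bounds on
quotients can then be handled without extended-real arithmetic. -/
lemma secondQuot_le_iff {φ : E → EReal} {x v w : E} {a t b : ℝ} (ha : φ x = a) (ht : 0 < t) :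
    secondQuot φ x v t w ≤ b ↔
      φ (x + t • w) ≤ ((a + t * ⟪v, w⟫ + t ^ 2 / 2 * b : ℝ) : EReal) := by
  have h2 : (0 : EReal) < ((t ^ 2 / 2 : ℝ) : EReal) := by
    exact_mod_cast (by positivity : 0 < t ^ 2 / 2)
  unfold secondQuot
  rw [EReal.div_le_iff_le_mul h2 (EReal.coe_ne_top _), ha,
    EReal.sub_le_iff_le_add (Or.inl (EReal.coe_ne_bot _)) (Or.inl (EReal.coe_ne_top _)),
    EReal.sub_le_iff_le_add (Or.inl (EReal.coe_ne_bot _)) (Or.inl (EReal.coe_ne_top _))]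
  norm_cast
  ring_nf

lemma lt_secondQuot_iff {φ : E → EReal} {x v w : E} {a t b : ℝ} (ha : φ x = a) (ht : 0 < t) :
    b < secondQuot φ x v t w ↔
      ((a + t * ⟪v, w⟫ + t ^ 2 / 2 * b : ℝ) : EReal) < φ (x + t • w) := by
  rw [← not_le, secondQuot_le_iff ha ht, not_le]

lemma norm_toLp_prod_le {X : Type*} [NormedAddCommGroup X] (p : X) (s : ℝ) :
    ‖WithLp.toLp 2 (p, s)‖ ≤ ‖p‖ + |s| := by
  have h := WithLp.prod_norm_sq_eq_of_L2 (WithLp.toLp 2 (p, s))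
  simp only [WithLp.toLp_fst, WithLp.toLp_snd, Real.norm_eq_abs] at h
  nlinarith [norm_nonneg (WithLp.toLp 2 (p, s)), norm_nonneg p, abs_nonneg s,
    mul_nonneg (norm_nonneg p) (abs_nonneg s)]

/-- Regular normals to a convex set are normals in the sense of convex analysis. -/
lemma inner_nonpos_of_mem_regularNormalCone {Ω : Set E} (hΩ : Convex ℝ Ω) {x v y : E}
    (hv : v ∈ regularNormalCone Ω x) (hy : y ∈ Ω) : ⟪v, y - x⟫ ≤ 0 := by
  obtain ⟨hx, hv⟩ := hv
  by_contra! hpos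
  have hne : 0 < ‖y - x‖ := by
    rw [norm_pos_iff]
    intro h0
    simp [h0] at hpos
  have hlim : Tendsto (fun t : ℝ => x + t • (y - x)) (𝓝[>] 0) (𝓝[Ω] x) := by
    refine tendsto_nhdsWithin_iff.2 ⟨?_, ?_⟩
    · have : Continuous fun t : ℝ => x + t • (y - x) := by fun_prop
      simpa using (this.tendsto 0).mono_left nhdsWithin_le_nhds
    · filter_upwards [Ioo_mem_nhdsGT (zero_lt_one' ℝ)] with t ht
      exact hΩ.add_smul_sub_mem hx hy ⟨ht.1.le, ht.2.le⟩
  -- Half the slope of `v` along the segment serves as tolerance, so a positive slope contradicts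
  -- regular normality.
  have hev := hlim.eventually (hv (⟪v, y - x⟫ / (2 * ‖y - x‖)) (by positivity))
  obtain ⟨t, h1, ht⟩ := (hev.and self_mem_nhdsWithin).exists
  have ht : 0 < t := ht
  rw [add_sub_cancel_left, inner_smul_right, norm_smul, Real.norm_eq_abs, abs_of_pos ht] at h1
  have : ⟪v, y - x⟫ / (2 * ‖y - x‖) * (t * ‖y - x‖) = t * ⟪v, y - x⟫ / 2 := by
    field_simp
  rw [this] at h1
  nlinarith [mul_pos ht hpos]

lemma inner_nonpos_of_mem_limitingNormalCone {Ω : Set E} (hΩ : Convex ℝ Ω) {x v y : E}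
    (hv : v ∈ limitingNormalCone Ω x) (hy : y ∈ Ω) : ⟪v, y - x⟫ ≤ 0 := by
  obtain ⟨-, xs, vs, -, hxs, hreg, hvs⟩ := hv
  have : Tendsto (fun k => ⟪vs k, y - xs k⟫) atTop (𝓝 ⟪v, y - x⟫) :=
    hvs.inner (tendsto_const_nhds.sub hxs)
  exact le_of_tendsto this (Eventually.of_forall fun k =>
    inner_nonpos_of_mem_regularNormalCone hΩ (hreg k) hy)

/-- For a convex function the limiting subdifferential is the subdifferential of convex
analysis. -/
lemma mem_limitingSubdiff_iff {ϑ : F → EReal} (hϑ : IsConvexFun ϑ) {y l : F} {a : ℝ}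
    (hy : ϑ y = a) :
    l ∈ limitingSubdiff ϑ y ↔ ∀ (p : F) (r : ℝ), ϑ p ≤ r → a + ⟪l, p - y⟫ ≤ r := by
  have hmem : WithLp.toLp 2 (y, a) ∈ epigraph ϑ := hy.le
  constructor
  · rintro ⟨-, -, h⟩ p r hp
    have hp' : WithLp.toLp 2 (p, r) ∈ epigraph ϑ := hp
    rw [hy, EReal.toReal_coe] at h
    have := inner_nonpos_of_mem_limitingNormalCone hϑ h hp'
    rw [WithLp.prod_inner_apply] at this
    simp at this
    linarith
  · intro h
    refine ⟨by simp [hy], by simp [hy], ?_⟩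
    rw [hy, EReal.toReal_coe]
    refine ⟨hmem, fun _ => _, fun _ => _, fun _ => hmem, tendsto_const_nhds,
      fun _ => ⟨hmem, fun ε hε => ?_⟩, tendsto_const_nhds⟩
    filter_upwards [self_mem_nhdsWithin] with z hz
    have hz' := h z.fst z.snd hz
    rw [WithLp.prod_inner_apply]
    have : 0 ≤ ε * ‖z - WithLp.toLp 2 (y, a)‖ := by positivity
    simp
    linarith

/-- Second-order Taylor expansion with Peano remainder. -/
lemma TwiceDifferentiableAt.taylor {f : E → F} {x : E} (hf : TwiceDifferentiableAt f x) {ε : ℝ}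
    (hε : 0 < ε) :
    ∀ᶠ h in 𝓝 (0 : E), ‖f (x + h) - f x - fderiv ℝ f x h - (1 / 2 : ℝ) • secondDeriv f x h h‖
      ≤ ε * ‖h‖ ^ 2 := by
  obtain ⟨hd, h2⟩ := hf
  have h3 := h2.hasFDerivAt.isLittleO.def hε
  obtain ⟨δ, hδ, hball⟩ := Metric.eventually_nhds_iff.1 (hd.and h3)
  filter_upwards [Metric.ball_mem_nhds (0 : E) hδ] with h hh
  rw [mem_ball_zero_iff] at hh
  set B := fderiv ℝ (fderiv ℝ f) x with hB
  -- The second derivative exists only at `x`, so the mean value inequality is applied on the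
  -- segment to `f` minus its linear and quadratic terms; differentiability of the derivative at `x`
  -- bounds the derivative of this remainder.
  let g : ℝ → F := fun s => f (x + s • h) - s • fderiv ℝ f x h - (s ^ 2 / 2) • B h h
  have hg : ∀ s ∈ Set.Icc (0 : ℝ) 1, HasDerivWithinAt g
      (fderiv ℝ f (x + s • h) h - fderiv ℝ f x h - s • B h h) (Set.Icc 0 1) s := by
    intro s hs
    have hin : dist (x + s • h) x < δ := by
      rw [dist_eq_norm, add_sub_cancel_left, norm_smul, Real.norm_eq_abs, abs_of_nonneg hs.1]
      nlinarith [norm_nonneg h, hs.2]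
    have e1 : HasDerivAt (fun s : ℝ => x + s • h) h s := by
      simpa using ((hasDerivAt_id s).smul_const h).const_add x
    have e2 := (hball hin).1.hasFDerivAt.comp_hasDerivAt s e1
    have e3 : HasDerivAt (fun s : ℝ => s • fderiv ℝ f x h) (fderiv ℝ f x h) s := by
      simpa using (hasDerivAt_id s).smul_const (fderiv ℝ f x h)
    have e4 : HasDerivAt (fun s : ℝ => (s ^ 2 / 2) • B h h) (s • B h h) s := by
      have := ((hasDerivAt_pow 2 s).div_const 2).smul_const (B h h)
      convert this using 2
      norm_num
    exact ((e2.sub e3).sub e4).hasDerivWithinAt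
  have hbound : ∀ s ∈ Set.Ico (0 : ℝ) 1,
      ‖fderiv ℝ f (x + s • h) h - fderiv ℝ f x h - s • B h h‖ ≤ ε * ‖h‖ ^ 2 := by
    intro s hs
    have hsh : ‖s • h‖ ≤ ‖h‖ := by
      rw [norm_smul, Real.norm_eq_abs, abs_of_nonneg hs.1]
      nlinarith [norm_nonneg h, hs.2]
    have hin : dist (x + s • h) x < δ := by
      rw [dist_eq_norm, add_sub_cancel_left]
      exact hsh.trans_lt hh
    have e := (hball hin).2
    rw [add_sub_cancel_left] at e
    have e' : fderiv ℝ f (x + s • h) h - fderiv ℝ f x h - s • B h h =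
        (fderiv ℝ f (x + s • h) - fderiv ℝ f x - B (s • h)) h := by simp
    rw [e']
    calc _ ≤ ‖fderiv ℝ f (x + s • h) - fderiv ℝ f x - B (s • h)‖ * ‖h‖ :=
          ContinuousLinearMap.le_opNorm _ _
      _ ≤ (ε * ‖h‖) * ‖h‖ := by gcongr; exact e.trans (by gcongr)
      _ = _ := by ring
  have := norm_image_sub_le_of_norm_deriv_le_segment' hg hbound 1 (by simp)
  simp only [g] at this
  simp only [one_smul, zero_smul, add_zero, one_pow, sub_zero, mul_one] at this
  norm_num at this
  convert this using 2
  simp only [secondDeriv, ← hB]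
  norm_num
  abel

/-- A map that is twice differentiable at a point is Lipschitz near it. -/
lemma TwiceDifferentiableAt.exists_lipschitzOnWith {f : E → F} {x : E}
    (hf : TwiceDifferentiableAt f x) : ∃ K : ℝ≥0, ∃ δ > 0, LipschitzOnWith K f (Metric.ball x δ) := by
  have hc : ∀ᶠ u in 𝓝 x, ‖fderiv ℝ f u‖₊ < ‖fderiv ℝ f x‖₊ + 1 :=
    hf.2.continuousAt.nnnorm.eventually_lt_const (lt_add_one _)
  obtain ⟨δ, hδ, h⟩ := Metric.eventually_nhds_iff_ball.1 (hf.1.and hc)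
  exact ⟨_, δ, hδ, (convex_ball x δ).lipschitzOnWith_of_nnnorm_fderiv_le (fun u hu => (h u hu).1)
    (fun u hu => (h u hu).2.le)⟩

open scoped Pointwise in
/-- A separation form of the Lagrange multiplier rule: if the linear perturbation
`z ↦ G + ⟪v, z⟫` stays below the exact penalization of a convex set `C` of pairs
`(point, value)`, then some multiplier certifies this. -/
lemma exists_multiplier_of_le_penalty [CompleteSpace F] {C : Set (F × ℝ)} (hC : Convex ℝ C)
    (hne : C.Nonempty) (A : E →L[ℝ] F) (q : F) (v : E) {G L : ℝ} (hL : 0 ≤ L)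
    (h : ∀ z, ∀ p ∈ C, G + ⟪v, z⟫ ≤ p.2 + L * ‖A z + q - p.1‖) :
    ∃ l : F, (∀ z, ⟪l, A z⟫ = ⟪v, z⟫) ∧
      ∀ p ∈ C, ∀ e, G + ⟪l, p.1 + e⟫ ≤ p.2 + L * ‖e‖ + ⟪l, q⟫ := by
  -- The strict epigraph of `L ‖·‖` is open, hence so is `C + U`; the hypothesis says exactly that
  -- `C + U` misses the affine graph `S`.
  let U : Set (F × ℝ) := {z | L * ‖z.1‖ < z.2}
  have hUc : Convex ℝ U := by
    rintro ⟨p, r⟩ hp ⟨p', r'⟩ hp' a b ha hb hab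
    simp only [U, Set.mem_ofPred_eq, Prod.smul_mk, Prod.mk_add_mk, smul_eq_mul] at *
    have : ‖a • p + b • p'‖ ≤ a * ‖p‖ + b * ‖p'‖ := by
      refine (norm_add_le _ _).trans ?_
      rw [norm_smul, norm_smul, Real.norm_eq_abs, Real.norm_eq_abs, abs_of_nonneg ha,
        abs_of_nonneg hb]
    have h1 := mul_le_mul_of_nonneg_left this hL
    rcases ha.eq_or_lt with rfl | ha
    · simp at hab
      subst hab
      simpa using hp'
    · nlinarith
  have hUo : IsOpen U := isOpen_lt (by fun_prop) (by fun_prop)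
  let S : Set (F × ℝ) := Set.range fun z : E => (A z + q, ⟪v, z⟫ + G)
  have hS : Convex ℝ S := by
    rintro _ ⟨z, rfl⟩ _ ⟨z', rfl⟩ a b ha hb hab
    refine ⟨a • z + b • z', ?_⟩
    ext
    · simp only [map_add, map_smul, Prod.smul_mk, Prod.mk_add_mk]
      rw [smul_add, smul_add]
      nth_rw 1 [← one_smul ℝ q]
      rw [← hab, add_smul]
      abel
    · simp only [inner_add_right, inner_smul_right, Prod.smul_mk, Prod.mk_add_mk, smul_eq_mul]
      linear_combination (-G) * hab
  have hdisj : Disjoint (C + U) S := by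
    rw [Set.disjoint_left]
    rintro _ ⟨p, hp, e, he, rfl⟩ ⟨z, hz⟩
    have h1 := congrArg Prod.fst hz
    have h2 := congrArg Prod.snd hz
    simp only [Prod.fst_add, Prod.snd_add] at h1 h2
    have h3 := h z p hp
    rw [h1, add_sub_cancel_left] at h3
    have : L * ‖e.1‖ < e.2 := he
    linarith
  obtain ⟨g, u, hg1, hg2⟩ := geometric_hahn_banach_open (hC.add hUc) hUo.add_left hS hdisj
  let γ := g (0, 1)
  let μ : StrongDual ℝ F := g.comp (ContinuousLinearMap.inl ℝ F ℝ)
  have hgs : ∀ p r, g (p, r) = μ p + r * γ := by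
    intro p r
    have : (p, r) = (p, (0 : ℝ)) + r • ((0 : F), (1 : ℝ)) := by simp
    rw [this, map_add, map_smul]
    rfl
  obtain ⟨p₀, hp₀⟩ := hne
  have hsep : ∀ p ∈ C, ∀ (e : F) (s : ℝ), 0 < s →
      μ (p.1 + e) + (p.2 + L * ‖e‖ + s) * γ < u := by
    intro p hp e s hs
    have := hg1 (p + (e, L * ‖e‖ + s)) ⟨p, hp, _, by simpa [U] using hs, rfl⟩
    rw [← hgs]
    convert this using 2
    ext <;> simp
    ring
  have hγ0 : γ ≤ 0 := by
    by_contra! hpos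
    obtain ⟨k, hk⟩ := exists_nat_gt ((u - μ (p₀.1) - p₀.2 * γ) / γ)
    have := hsep p₀ hp₀ 0 (k + 1) (by positivity)
    rw [div_lt_iff₀ hpos] at hk
    simp at this
    nlinarith
  -- The separating hyperplane is not vertical because the penalty is finite everywhere: `C + U`
  -- projects onto all of `F`, in particular onto a point below `S`.
  have hγ : γ < 0 := by
    refine lt_of_le_of_ne hγ0 fun h0 => ?_
    have h1 : ∀ e, μ (p₀.1 + e) < u := fun e => by
      simpa [h0] using hsep p₀ hp₀ e 1 one_pos
    have h2 := hg2 _ ⟨0, rfl⟩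
    rw [hgs, h0] at h2
    have h3 := h1 (A 0 + q - p₀.1)
    rw [add_sub_cancel] at h3
    linarith
  let l : F := (InnerProductSpace.toDual ℝ F).symm ((-γ)⁻¹ • μ)
  have hl : ∀ p, μ p = -γ * ⟪l, p⟫ := by
    intro p
    have : ⟪l, p⟫ = (-γ)⁻¹ * μ p := by
      simp only [l, InnerProductSpace.toDual_symm_apply]
      rfl
    have := hγ.ne
    rw [‹⟪l, p⟫ = _›]
    field_simp
  have hS' : ∀ z, u ≤ -γ * (⟪l, A z⟫ - ⟪v, z⟫ + ⟪l, q⟫ - G) := by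
    intro z
    have := hg2 _ ⟨z, rfl⟩
    simp only [hgs, hl, inner_add_right] at this
    linarith
  -- An affine function of `z` bounded below has zero linear part; the multiple of `z` below pushes
  -- it under `u` if `d ≠ 0`.
  have hlin : ∀ z, ⟪l, A z⟫ - ⟪v, z⟫ = 0 := by
    intro z
    by_contra hz
    set d := ⟪l, A z⟫ - ⟪v, z⟫ with hd
    have h1 := hS' ((-(|u| + |γ * (⟪l, q⟫ - G)| + 1) / (-γ * d)) • z)
    rw [map_smul, inner_smul_right, inner_smul_right, ← mul_sub, ← hd] at h1
    have h2 : -γ * ((-(|u| + |γ * (⟪l, q⟫ - G)| + 1) / (-γ * d)) * d + ⟪l, q⟫ - G) =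
        -(|u| + |γ * (⟪l, q⟫ - G)| + 1) - γ * (⟪l, q⟫ - G) := by
      have := hγ.ne
      field_simp
      ring
    rw [h2] at h1
    linarith [neg_abs_le u, neg_abs_le (γ * (⟪l, q⟫ - G))]
  refine ⟨l, fun z => by linarith [hlin z], fun p hp e => ?_⟩
  have h0 := hS' 0
  simp only [map_zero, inner_zero_right, sub_zero, zero_add] at h0
  refine le_of_forall_pos_le_add fun s hs => ?_
  have h1 := hsep p hp e s hs
  rw [hl] at h1
  have h2 : -γ * (⟪l, p.1 + e⟫ - (p.2 + L * ‖e‖ + s)) ≤ -γ * (⟪l, q⟫ - G) := by linarith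
  have := le_of_mul_le_mul_left h2 (by linarith)
  linarith

end Basics

/-! ### Convex piecewise linear-quadratic functions -/

section Piecewise

variable {E F : Type*} [NormedAddCommGroup E] [InnerProductSpace ℝ E]
  [NormedAddCommGroup F] [InnerProductSpace ℝ F]

/-- A convex piecewise linear-quadratic function is Lipschitz relative to its domain, locally. -/
lemma IsPWLQ.exists_lipschitz [FiniteDimensional ℝ F] {ϑ : F → EReal} (h : IsPWLQ ϑ)
    (hc : IsConvexFun ϑ) (y : F) :
    ∃ ℓ : ℝ, 0 ≤ ℓ ∧ ∃ δ > 0, ∀ p ∈ Metric.ball y δ, ∀ p' ∈ Metric.ball y δ, p' ∈ effDom ϑ →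
      ∀ r : ℝ, ϑ p ≤ r → ϑ p' ≤ ((r + ℓ * ‖p' - p‖ : ℝ) : EReal) := by
  obtain ⟨s, Ω, A, a, α, hpoly, -, hdom, hval⟩ := h
  let Q : Fin s → F → ℝ := fun i p => 1 / 2 * ⟪A i p, p⟫ + ⟪a i, p⟫ + α i
  have hQ : ∀ i, ∃ K : ℝ≥0, ∃ t ∈ 𝓝 y, LipschitzOnWith K (Q i) t := by
    intro i
    have hA : ContDiff ℝ 1 (A i) := (LinearMap.toContinuousLinearMap (A i)).contDiff
    have : ContDiff ℝ 1 (Q i) := by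
      have h1 := hA.inner ℝ (contDiff_id (𝕜 := ℝ) (E := F) (n := 1))
      have h2 := (contDiff_const (𝕜 := ℝ) (n := 1) (c := a i)).inner ℝ
        (contDiff_id (𝕜 := ℝ) (E := F) (n := 1))
      exact ((contDiff_const.mul h1).add h2).add contDiff_const
    exact this.contDiffAt.exists_lipschitzOnWith
  choose K t ht hLip using hQ
  obtain ⟨δ, hδ, hball⟩ := Metric.mem_nhds_iff.1 (Filter.iInter_mem.2 ht)
  refine ⟨∑ i, (K i : ℝ), by positivity, δ, hδ, fun p hp p' hp' hp'd r hr => ?_⟩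
  have hpd : p ∈ effDom ϑ := hr.trans_lt (EReal.coe_lt_top r)
  have hreal : ∀ z ∈ effDom ϑ, ∃ r : ℝ, ϑ z = r := by
    intro z hz
    rw [hdom] at hz
    obtain ⟨i, hi⟩ := Set.mem_iUnion.1 hz
    exact ⟨_, hval i z hi⟩
  obtain ⟨r', hr'⟩ := hreal p' hp'd
  have hseg : ∀ τ ∈ Set.Ioo (0 : ℝ) 1,
      ϑ ((1 - τ) • p + τ • p') ≤ (((1 - τ) * r + τ * r' : ℝ) : EReal) := fun τ hτ =>
    hc.combo hr hr'.le (by linarith [hτ.2]) hτ.1.le (by ring)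
  -- Finitely many pieces cover the segment near `p'`, so one of them contains points arbitrarily
  -- close to `p'`, and `p'` itself by closedness. A Lipschitz bound on that last stretch suffices:
  -- convexity carries the slope back to `p`.
  have hev : ∀ᶠ τ in 𝓝[<] (1 : ℝ), ∃ i, (1 - τ) • p + τ • p' ∈ Ω i := by
    filter_upwards [Ioo_mem_nhdsLT (zero_lt_one' ℝ)] with τ hτ
    have : (1 - τ) • p + τ • p' ∈ effDom ϑ := (hseg τ hτ).trans_lt (EReal.coe_lt_top _)
    rw [hdom] at this
    exact Set.mem_iUnion.1 this
  obtain ⟨i, hi⟩ := Filter.frequently_exists.1 hev.frequently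
  have hp'i : p' ∈ Ω i := by
    have hcont : Tendsto (fun τ : ℝ => (1 - τ) • p + τ • p') (𝓝[<] 1) (𝓝 p') := by
      have : Continuous fun τ : ℝ => (1 - τ) • p + τ • p' := by fun_prop
      simpa using (this.tendsto 1).mono_left nhdsWithin_le_nhds
    exact (hpoly i).isClosed.mem_of_frequently_of_tendsto hi hcont
  obtain ⟨τ, hτi, hτ⟩ := (hi.and_eventually (Ioo_mem_nhdsLT (zero_lt_one' ℝ))).exists
  set z := (1 - τ) • p + τ • p' with hz
  have hzball : z ∈ Metric.ball y δ :=
    (convex_ball y δ) hp hp' (by linarith [hτ.2]) hτ.1.le (by ring)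
  have h1 := (hLip i).dist_le_mul p' (Set.mem_iInter.1 (hball hp') i) z
    (Set.mem_iInter.1 (hball hzball) i)
  have h2 : p' - z = (1 - τ) • (p' - p) := by
    rw [hz]
    module
  rw [Real.dist_eq, dist_eq_norm, h2, norm_smul, Real.norm_eq_abs,
    abs_of_pos (by linarith [hτ.2] : 0 < 1 - τ)] at h1
  have h3 := hseg τ hτ
  rw [← hz, hval i z hτi, EReal.coe_le_coe_iff] at h3
  have h4 : r' = Q i p' := by
    have := hval i p' hp'i
    rw [hr', EReal.coe_eq_coe_iff] at this
    exact this
  have h5 : (K i : ℝ) ≤ ∑ j, (K j : ℝ) :=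
    Finset.single_le_sum (f := fun j => (K j : ℝ)) (fun j _ => (K j).2) (Finset.mem_univ i)
  rw [hr', EReal.coe_le_coe_iff]
  have h6 := (le_abs_self _).trans h1
  have h7 : Q i z ≤ (1 - τ) * r + τ * r' := h3
  have h8 : (1 - τ) * (r' - r) ≤ (1 - τ) * (K i * ‖p' - p‖) := by linarith
  have h9 := le_of_mul_le_mul_left h8 (by linarith [hτ.2])
  have h10 := mul_le_mul_of_nonneg_right h5 (norm_nonneg (p' - p))
  linarith

lemma tendsto_add_smul (y u : F) :
    Tendsto (fun p : ℝ × F => y + p.1 • p.2) (𝓝[>] (0 : ℝ) ×ˢ 𝓝 u) (𝓝 y) := by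
  have : Continuous fun p : ℝ × F => y + p.1 • p.2 := by fun_prop
  have h := this.tendsto (0, u)
  rw [nhds_prod_eq] at h
  simpa using h.mono_left (Filter.prod_mono_left _ nhdsWithin_le_nhds)

lemma eventually_pos_fst {X : Type*} [TopologicalSpace X] (u : X) :
    ∀ᶠ p : ℝ × X in 𝓝[>] (0 : ℝ) ×ˢ 𝓝 u, 0 < p.1 :=
  (eventually_mem_nhdsWithin (a := (0 : ℝ)) (s := Set.Ioi 0)).prod_inl _

/-- Directions tangent to a polyhedral set are feasible. -/
lemma IsPolyhedralSet.mem_of_frequently {Ω : Set F} (h : IsPolyhedralSet Ω) {y u : F}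
    (hf : ∃ᶠ p : ℝ × F in 𝓝[>] (0 : ℝ) ×ˢ 𝓝 u, y + p.1 • p.2 ∈ Ω) :
    y ∈ Ω ∧ ∀ᶠ t in 𝓝[>] (0 : ℝ), y + t • u ∈ Ω := by
  have hy : y ∈ Ω := h.isClosed.mem_of_frequently_of_tendsto hf (tendsto_add_smul y u)
  refine ⟨hy, ?_⟩
  obtain ⟨k, a, b, rfl⟩ := h
  simp only [Set.mem_ofPred_eq] at hf hy ⊢
  refine eventually_all.2 fun i => ?_
  -- Inactive constraints persist by continuity; for an active one feasibility only constrains the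
  -- sign of `⟪a i, ·⟫`, which passes to the limit.
  rcases (hy i).lt_or_eq with hlt | heq
  · have : Continuous fun t : ℝ => ⟪a i, y + t • u⟫ := by fun_prop
    have h2 := (this.tendsto 0).mono_left (nhdsWithin_le_nhds (s := Set.Ioi 0))
    simp only [zero_smul, add_zero] at h2
    exact (h2.eventually_lt_const hlt).mono fun _ => le_of_lt
  · have hfi : ∃ᶠ p : ℝ × F in 𝓝[>] (0 : ℝ) ×ˢ 𝓝 u, ⟪a i, p.2⟫ ∈ Set.Iic (0 : ℝ) := by
      refine (hf.and_eventually (eventually_pos_fst u)).mono ?_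
      rintro ⟨t, u'⟩ ⟨h1, ht⟩
      have h2 := h1 i
      simp only [inner_add_right, inner_smul_right] at h2 ht
      rw [heq] at h2
      rw [Set.mem_Iic]
      by_contra! h3
      nlinarith [mul_pos ht h3]
    have hu : ⟪a i, u⟫ ∈ Set.Iic (0 : ℝ) := by
      refine isClosed_Iic.mem_of_frequently_of_tendsto hfi ?_
      exact (continuous_const.inner continuous_id).continuousAt.tendsto.comp tendsto_snd
    filter_upwards [self_mem_nhdsWithin] with t ht
    have ht : 0 < t := ht
    rw [inner_add_right, inner_smul_right, heq]
    have : ⟪a i, u⟫ ≤ 0 := hu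
    nlinarith

/-- Second-order behaviour of a convex piecewise linear-quadratic function along directions where
the second subderivative is finite. -/
lemma IsPWLQ.expansion_of_secondSubderiv_lt [FiniteDimensional ℝ F] {ϑ : F → EReal}
    (h : IsPWLQ ϑ) {y l u : F} {θ : ℝ} (hθ : ϑ y = θ)
    (hl : ∀ (p : F) (r : ℝ), ϑ p ≤ r → θ + ⟪l, p - y⟫ ≤ r) {b : ℝ}
    (hb : secondSubderiv ϑ y l u < b) :
    ∃ c ≤ b, ∀ᶠ t in 𝓝[>] (0 : ℝ),
      ϑ (y + t • u) = ((θ + t * ⟪l, u⟫ + t ^ 2 / 2 * c : ℝ) : EReal) := by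
  obtain ⟨s, Ω, A, a, α, hpoly, hsymm, hdom, hval⟩ := h
  have hfreq := frequently_lt_of_liminf_lt (by isBoundedDefault) hb
  have hfreq2 : ∃ᶠ p : ℝ × F in 𝓝[>] (0 : ℝ) ×ˢ 𝓝 u, ∃ i, y + p.1 • p.2 ∈ Ω i ∧
      ϑ (y + p.1 • p.2) ≤ ((θ + p.1 * ⟪l, p.2⟫ + p.1 ^ 2 / 2 * b : ℝ) : EReal) := by
    refine (hfreq.and_eventually (eventually_pos_fst u)).mono ?_
    rintro ⟨t, u'⟩ ⟨h1, ht⟩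
    have h2 := (secondQuot_le_iff hθ ht).1 h1.le
    have h3 : y + t • u' ∈ effDom ϑ := h2.trans_lt (EReal.coe_lt_top _)
    rw [hdom] at h3
    obtain ⟨i, hi⟩ := Set.mem_iUnion.1 h3
    exact ⟨i, hi, h2⟩
  -- One piece is met by infinitely many of the points witnessing the small lower limit; its
  -- quadratic formula gives the expansion along `u`.
  obtain ⟨i, hi⟩ := Filter.frequently_exists.1 hfreq2
  obtain ⟨hyi, hui⟩ := (hpoly i).mem_of_frequently (hi.mono fun p hp => hp.1)
  set g : F := A i y + a i with hg
  have hexp : ∀ (t : ℝ) (w : F), y + t • w ∈ Ω i →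
      ϑ (y + t • w) = ((θ + t * ⟪g, w⟫ + t ^ 2 / 2 * ⟪A i w, w⟫ : ℝ) : EReal) := by
    intro t w hw
    have h1 := hval i y hyi
    rw [hθ, EReal.coe_eq_coe_iff] at h1
    rw [hval i _ hw, EReal.coe_eq_coe_iff, h1]
    have h2 : ⟪A i w, y⟫ = ⟪A i y, w⟫ := by rw [hsymm i, real_inner_comm]
    simp only [hg, map_add, map_smul, inner_add_left, inner_add_right, inner_smul_left,
      inner_smul_right, h2]
    simp
    ring
  have hge : ∀ (t : ℝ) (w : F), 0 < t → y + t • w ∈ Ω i → ⟪l, w⟫ ≤ ⟪g, w⟫ := by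
    intro t w ht hw
    have hseg : ∀ᶠ τ in 𝓝[>] (0 : ℝ), ⟪l, w⟫ ≤ ⟪g, w⟫ + τ / 2 * ⟪A i w, w⟫ := by
      filter_upwards [Ioo_mem_nhdsGT ht] with τ hτ
      have h1 : y + τ • w ∈ Ω i := by
        have := (hpoly i).convex.add_smul_mem hyi hw
          (t := τ / t) ⟨by have := hτ.1; positivity, (div_le_one ht).2 hτ.2.le⟩
        rwa [smul_smul, div_mul_cancel₀ _ ht.ne'] at this
      have h2 := hl _ _ (hexp τ w h1).le
      rw [add_sub_cancel_left, inner_smul_right] at h2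
      refine le_of_mul_le_mul_left ?_ hτ.1
      linarith
    have hlim : Tendsto (fun τ : ℝ => ⟪g, w⟫ + τ / 2 * ⟪A i w, w⟫) (𝓝[>] 0) (𝓝 ⟪g, w⟫) := by
      have : Continuous fun τ : ℝ => ⟪g, w⟫ + τ / 2 * ⟪A i w, w⟫ := by fun_prop
      simpa using (this.tendsto 0).mono_left (nhdsWithin_le_nhds (s := Set.Ioi 0))
    exact ge_of_tendsto hlim hseg
  have hA : Continuous (A i) := (A i).continuous_of_finiteDimensional
  -- The quotient bound reads `⟪g - l, w⟫ + t / 2 * (⟪A i w, w⟫ - b) ≤ 0`. In the limit `⟪g - l, u⟫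
  -- ≤ 0`, the reverse of `hge`; and as `⟪g - l, w⟫ ≥ 0`, the quadratic term is at most `b`.
  have hstep : ∃ᶠ p : ℝ × F in 𝓝[>] (0 : ℝ) ×ˢ 𝓝 u,
      ⟪g - l, p.2⟫ + p.1 / 2 * (⟪A i p.2, p.2⟫ - b) ∈ Set.Iic (0 : ℝ) ∧
      ⟪A i p.2, p.2⟫ ∈ Set.Iic b := by
    refine (hi.and_eventually (eventually_pos_fst u)).mono ?_
    rintro ⟨t, w⟩ ⟨⟨h1, h2⟩, ht⟩
    simp only at h1 h2 ht ⊢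
    rw [hexp t w h1, EReal.coe_le_coe_iff] at h2
    have h3 := hge t w ht h1
    rw [Set.mem_Iic, Set.mem_Iic, inner_sub_left]
    constructor
    · refine le_of_mul_le_mul_left ?_ ht
      linarith
    · have : t ^ 2 / 2 * ⟪A i w, w⟫ ≤ t ^ 2 / 2 * b := by nlinarith
      exact le_of_mul_le_mul_left this (by positivity)
  have hc1 : ⟪A i u, u⟫ ≤ b := by
    refine isClosed_Iic.mem_of_frequently_of_tendsto (hstep.mono fun p hp => hp.2) ?_
    exact (hA.inner continuous_id).continuousAt.tendsto.comp tendsto_snd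
  have hc2 : ⟪g - l, u⟫ ≤ 0 := by
    refine isClosed_Iic.mem_of_frequently_of_tendsto (hstep.mono fun p hp => hp.1) ?_
    have : Continuous fun p : ℝ × F => ⟪g - l, p.2⟫ + p.1 / 2 * (⟪A i p.2, p.2⟫ - b) := by
      fun_prop
    have h := this.tendsto (0, u)
    rw [nhds_prod_eq] at h
    simpa using h.mono_left (Filter.prod_mono_left _ nhdsWithin_le_nhds)
  obtain ⟨t₀, hu₀, ht₀⟩ := (hui.and self_mem_nhdsWithin).exists
  have hgl : ⟪g, u⟫ = ⟪l, u⟫ := by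
    rw [inner_sub_left] at hc2
    exact le_antisymm (by linarith) (hge t₀ u ht₀ hu₀)
  refine ⟨_, hc1, hui.mono fun t ht => ?_⟩
  rw [hexp t u ht, hgl]

end Piecewise

/-! ### Metric subregularity as a correction property -/

section Approximation

variable {E F : Type*} [NormedAddCommGroup E] [InnerProductSpace ℝ E]
  [NormedAddCommGroup F] [InnerProductSpace ℝ F] [FiniteDimensional ℝ F]

/-- Under the metric subregularity qualification condition, near `x` every approximate solution
of the inclusion `f u ∈ dom ϑ` can be corrected to an exact one, with linear control of the
displacement and of the value of the composition. -/
lemma IsFullySubamenableRep.exists_correction {φ : E → EReal} {x : E} {f : E → F} {ϑ : F → EReal}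
    (h : IsFullySubamenableRep φ x f ϑ) :
    ∃ κ L δ : ℝ, 0 ≤ κ ∧ 0 ≤ L ∧ 0 < δ ∧ ∀ u ∈ Metric.ball x δ, ∀ p ∈ Metric.ball (f x) δ,
      ∀ r : ℝ, ϑ p ≤ r → ∃ u', ‖u' - u‖ ≤ κ * ‖f u - p‖ ∧
        φ u' ≤ ((r + L * ‖f u - p‖ : ℝ) : EReal) := by
  obtain ⟨-, κ, hκ⟩ := h.msqc
  obtain ⟨K, r₁, hr₁, hK⟩ := h.twiceDiff.exists_lipschitzOnWith
  obtain ⟨ℓ, hℓ, r₂, hr₂, hLip⟩ := h.isPWLQ.exists_lipschitz h.isConvex (f x)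
  obtain ⟨r₃, hr₃, hev⟩ := Metric.eventually_nhds_iff_ball.1 (h.eq_comp.and hκ)
  have hKn : (0 : ℝ) ≤ K := K.2
  have hκn : (0 : ℝ) ≤ κ := κ.2
  set r := min (min r₁ r₃) (r₂ / (K + 1)) with hr
  have hrpos : 0 < r := by positivity
  have hrr1 : r ≤ r₁ := (min_le_left _ _).trans (min_le_left _ _)
  have hrr3 : r ≤ r₃ := (min_le_left _ _).trans (min_le_right _ _)
  have hrr2 : (K + 1) * r ≤ r₂ := by
    have : r ≤ r₂ / (K + 1) := min_le_right _ _
    rwa [le_div_iff₀' (by positivity)] at this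
  -- Chosen so that `r / M` plus the largest displacement `(κ + 1) * ((K + 1) * (r / M))` is exactly
  -- `r`, keeping the corrected point in the ball of radius `r`.
  set M : ℝ := 1 + (κ + 1) * (K + 1) with hM
  have hM1 : 1 ≤ M := by
    have : 0 ≤ ((κ : ℝ) + 1) * (K + 1) := by positivity
    linarith
  have hδpos : 0 < r / M := by positivity
  refine ⟨κ + 1, ℓ * (K * (κ + 1) + 1), r / M, by positivity, by positivity, hδpos,
    fun u hu p hp ρ hρ => ?_⟩
  have hδr : r / M ≤ r := div_le_self hrpos.le hM1
  have hδM : r / M * M = r := div_mul_cancel₀ _ (by positivity)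
  have hxr : x ∈ Metric.ball x r₁ := Metric.mem_ball_self hr₁
  have hu1 : u ∈ Metric.ball x r₁ := Metric.ball_subset_ball (hδr.trans hrr1) hu
  have hu3 : u ∈ Metric.ball x r₃ := Metric.ball_subset_ball (hδr.trans hrr3) hu
  have hfu := hK.dist_le_mul u hu1 x hxr
  rw [Metric.mem_ball] at hu hp
  have hη : ‖f u - p‖ ≤ (K + 1) * (r / M) := by
    rw [← dist_eq_norm]
    have := dist_triangle_right (f u) p (f x)
    have h2 := mul_le_mul_of_nonneg_left hu.le hKn
    linarith
  -- The distance to the feasible set need not be attained, so `κ` is enlarged to `κ + 1`; a zero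
  -- residual leaves no slack and is treated apart.
  have hex : ∃ u', f u' ∈ effDom ϑ ∧ ‖u' - u‖ ≤ (κ + 1) * ‖f u - p‖ := by
    have hpd : p ∈ effDom ϑ := hρ.trans_lt (EReal.coe_lt_top _)
    rcases eq_or_ne (f u) p with heq | hne
    · exact ⟨u, heq ▸ hpd, by simp [heq]⟩
    · have h1 := (hev u hu3).2
      have hmem : f u - p ∈ {z : F | ∃ y ∈ effDom ϑ, z = f u - y} := ⟨p, hpd, rfl⟩
      have h2 := Metric.infEDist_le_edist_of_mem (x := (0 : F)) hmem
      have hpos : 0 < ‖f u - p‖ := norm_pos_iff.2 (sub_ne_zero.2 hne)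
      have h3 : edist (0 : F) (f u - p) = ENNReal.ofReal ‖f u - p‖ := by
        rw [edist_dist, dist_zero_left]
      have h4 : Metric.infEDist u {u' | (0 : F) ∈ {z : F | ∃ y ∈ effDom ϑ, z = f u' - y}} <
          ENNReal.ofReal ((κ + 1) * ‖f u - p‖) := by
        refine h1.trans_lt ((mul_le_mul_right (h2.trans h3.le) _).trans_lt ?_)
        rw [← ENNReal.ofReal_coe_nnreal, ← ENNReal.ofReal_mul hκn]
        exact (ENNReal.ofReal_lt_ofReal_iff (by positivity)).2 (by nlinarith)
      obtain ⟨u', ⟨y, hy, hy'⟩, hd⟩ := Metric.infEDist_lt_iff.1 h4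
      refine ⟨u', ?_, ?_⟩
      · rw [sub_eq_zero.1 hy'.symm]
        exact hy
      · rw [edist_dist, ENNReal.ofReal_lt_ofReal_iff (by positivity), dist_comm,
          dist_eq_norm] at hd
        exact hd.le
  obtain ⟨u', hu'd, hu'⟩ := hex
  refine ⟨u', hu', ?_⟩
  have hu'r : dist u' x < r := by
    have h1 := dist_triangle u' u x
    rw [dist_eq_norm u' u] at h1
    have h2 := mul_le_mul_of_nonneg_left hη (by positivity : (0 : ℝ) ≤ κ + 1)
    have h3 : r / M + (κ + 1) * ((K + 1) * (r / M)) = r := by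
      have key : ∀ d : ℝ, d + (κ + 1) * ((K + 1) * d) = d * M := fun d => by
        rw [hM]
        ring
      rw [key, hδM]
    linarith
  have hu'1 : u' ∈ Metric.ball x r₁ := Metric.ball_subset_ball hrr1 hu'r
  have hu'3 : u' ∈ Metric.ball x r₃ := Metric.ball_subset_ball hrr3 hu'r
  have hfu' := hK.dist_le_mul u' hu'1 x hxr
  have hfu'2 : f u' ∈ Metric.ball (f x) r₂ := by
    rw [Metric.mem_ball]
    have h2 := mul_le_mul_of_nonneg_left hu'r.le hKn
    linarith
  have hp2 : p ∈ Metric.ball (f x) r₂ := by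
    rw [Metric.mem_ball]
    have h2 : 0 ≤ K * r := by positivity
    linarith
  rw [(hev u' hu'3).1]
  refine (hLip p hp2 (f u') hfu'2 hu'd ρ hρ).trans ?_
  rw [EReal.coe_le_coe_iff]
  have h1 : ‖f u' - p‖ ≤ (K * (κ + 1) + 1) * ‖f u - p‖ := by
    have h2 := hK.dist_le_mul u' hu'1 u hu1
    rw [dist_eq_norm, dist_eq_norm] at h2
    have h3 : ‖f u' - p‖ ≤ ‖f u' - f u‖ + ‖f u - p‖ := norm_sub_le_norm_sub_add_norm_sub _ _ _
    have h4 := mul_le_mul_of_nonneg_left hu' hKn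
    linarith
  have := mul_le_mul_of_nonneg_left h1 hℓ
  linarith

end Approximation

/-! ### First-order penalty and existence of multipliers -/

section FirstOrder

variable {E F : Type*} [NormedAddCommGroup E] [InnerProductSpace ℝ E]
  [NormedAddCommGroup F] [InnerProductSpace ℝ F]

/-- Regular normals to the epigraph of a composition satisfy a first-order exact penalty
inequality, with constants coming from the correction property of the constraint system. -/
lemma inner_le_penalty_of_mem_regularNormalCone {φ : E → EReal} {x : E} {f : E → F}
    {ϑ : F → EReal} (hconv : IsConvexFun ϑ) {κ L δ : ℝ} (hL : 0 ≤ L)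
    (hcorr : ∀ u ∈ Metric.ball x δ, ∀ p ∈ Metric.ball (f x) δ, ∀ r : ℝ, ϑ p ≤ r →
      ∃ u', ‖u' - u‖ ≤ κ * ‖f u - p‖ ∧ φ u' ≤ ((r + L * ‖f u - p‖ : ℝ) : EReal))
    {x' v : E} {α β : ℝ} (hx' : x' ∈ Metric.ball x δ) (hfx' : f x' ∈ Metric.ball (f x) δ)
    (hd : DifferentiableAt ℝ f x') (hα : ϑ (f x') ≤ α)
    (hreg : WithLp.toLp 2 (v, -β) ∈ regularNormalCone (epigraph φ) (WithLp.toLp 2 (x', α)))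
    (w : E) {y' : F} {ρ : ℝ} (hy' : ϑ y' ≤ ρ) :
    ⟪v, w⟫ ≤ β * (ρ - α) + (‖v‖ * κ + β * L) * ‖fderiv ℝ f x' w - (y' - f x')‖ := by
  set N := ‖fderiv ℝ f x' w - (y' - f x')‖ with hN
  let n : ℝ → ℝ := fun t => ‖t⁻¹ • (f (x' + t • w) - f x') - (y' - f x')‖
  have hn : Tendsto n (𝓝[>] 0) (𝓝 N) :=
    ((hd.hasFDerivAt.hasLineDerivAt w).tendsto_slope_zero_right.sub tendsto_const_nhds).norm
  let b : ℝ → ℝ := fun t => ‖w‖ + κ * n t + (|ρ - α| + L * n t)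
  have hb : Tendsto b (𝓝[>] 0) (𝓝 (‖w‖ + κ * N + (|ρ - α| + L * N))) :=
    (tendsto_const_nhds.add (hn.const_mul κ)).add (tendsto_const_nhds.add (hn.const_mul L))
  have hid : Tendsto (fun t : ℝ => t) (𝓝[>] 0) (𝓝 0) := nhdsWithin_le_nhds
  have hε : ∀ ε > (0 : ℝ), ⟪v, w⟫ ≤ β * (ρ - α) + (‖v‖ * κ + β * L) * N +
      ε * (‖w‖ + κ * N + (|ρ - α| + L * N)) := by
    intro ε hε
    obtain ⟨R, hR, hreg'⟩ := Metric.eventually_nhds_iff.1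
      (eventually_nhdsWithin_iff.1 (hreg.2 ε hε))
    have hlim : Tendsto (fun t => β * (ρ - α) + (‖v‖ * κ + β * L) * n t + ε * b t) (𝓝[>] 0)
        (𝓝 (β * (ρ - α) + (‖v‖ * κ + β * L) * N +
          ε * (‖w‖ + κ * N + (|ρ - α| + L * N)))) :=
      (tendsto_const_nhds.add (hn.const_mul _)).add (hb.const_mul _)
    refine ge_of_tendsto hlim ?_
    have hsmall : ∀ᶠ t in 𝓝[>] (0 : ℝ), t * b t < R := by
      have := hid.mul hb
      rw [zero_mul] at this
      exact this.eventually_lt_const hR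
    have hx1 : ∀ᶠ t in 𝓝[>] (0 : ℝ), x' + t • w ∈ Metric.ball x δ := by
      have : Continuous fun t : ℝ => x' + t • w := by fun_prop
      have h2 := (this.tendsto 0).mono_left (nhdsWithin_le_nhds (s := Set.Ioi 0))
      rw [zero_smul, add_zero] at h2
      exact h2.eventually_mem (Metric.isOpen_ball.mem_nhds hx')
    have hy1 : ∀ᶠ t in 𝓝[>] (0 : ℝ), (1 - t) • f x' + t • y' ∈ Metric.ball (f x) δ := by
      have : Continuous fun t : ℝ => (1 - t) • f x' + t • y' := by fun_prop
      have h2 := (this.tendsto 0).mono_left (nhdsWithin_le_nhds (s := Set.Ioi 0))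
      rw [zero_smul, add_zero, sub_zero, one_smul] at h2
      exact h2.eventually_mem (Metric.isOpen_ball.mem_nhds hfx')
    filter_upwards [hsmall, hx1, hy1, Ioo_mem_nhdsGT (zero_lt_one' ℝ)] with t h1 h2 h3 ht
    have ht0 := ht.1
    -- The test point for the regular normal is the correction of `x' + t w` towards the point at
    -- parameter `t` on the segment from `f x'` to `y'`; its residual is `t * n t`.
    obtain ⟨u, hu, hφu⟩ := hcorr _ h2 _ h3 _
      (hconv.combo hα hy' (by linarith [ht.2]) ht0.le (by ring))
    have hη : ‖f (x' + t • w) - ((1 - t) • f x' + t • y')‖ = t * n t := by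
      have : f (x' + t • w) - ((1 - t) • f x' + t • y') =
          t • (t⁻¹ • (f (x' + t • w) - f x') - (y' - f x')) := by
        rw [smul_sub, smul_smul, mul_inv_cancel₀ ht0.ne']
        module
      rw [this, norm_smul, Real.norm_eq_abs, abs_of_pos ht0]
    rw [hη] at hu hφu
    set s := (1 - t) * α + t * ρ + L * (t * n t) with hs
    have hn0 : 0 ≤ n t := norm_nonneg _
    have hux : ‖u - x'‖ ≤ t * (‖w‖ + κ * n t) := by
      have h4 : u - x' = (u - (x' + t • w)) + t • w := by abel
      rw [h4]
      refine (norm_add_le _ _).trans ?_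
      rw [norm_smul, Real.norm_eq_abs, abs_of_pos ht0]
      linarith
    have hsα : |s - α| ≤ t * (|ρ - α| + L * n t) := by
      have h4 : s - α = t * ((ρ - α) + L * n t) := by rw [hs]; ring
      rw [h4, abs_mul, abs_of_pos ht0]
      gcongr
      refine (abs_add_le _ _).trans ?_
      rw [abs_of_nonneg (by positivity : 0 ≤ L * n t)]
    have hnorm : ‖WithLp.toLp 2 (u, s) - WithLp.toLp 2 (x', α)‖ ≤ t * b t := by
      rw [← WithLp.toLp_sub, Prod.mk_sub_mk]
      refine (norm_toLp_prod_le _ _).trans ?_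
      simp only [b]
      linarith
    have hmem : WithLp.toLp 2 (u, s) ∈ epigraph φ := hφu
    have h5 := hreg' (by rw [dist_eq_norm]; exact hnorm.trans_lt h1) hmem
    rw [WithLp.prod_inner_apply] at h5
    simp only [WithLp.ofLp_sub, Prod.fst_sub, Prod.snd_sub] at h5
    have h6 := h5.trans (mul_le_mul_of_nonneg_left hnorm hε.le)
    have h7 : ⟪v, u - x'⟫ = ⟪v, u - (x' + t • w)⟫ + t * ⟪v, w⟫ := by
      rw [← inner_smul_right, ← inner_add_right]
      congr 1
      abel
    have h8 : -(‖v‖ * (κ * (t * n t))) ≤ ⟪v, u - (x' + t • w)⟫ := by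
      have h9 := abs_real_inner_le_norm v (u - (x' + t • w))
      have h10 := mul_le_mul_of_nonneg_left hu (norm_nonneg v)
      linarith [neg_abs_le ⟪v, u - (x' + t • w)⟫]
    have h11 : (inner ℝ (-β) (s - α) : ℝ) = -β * (s - α) := by
      simp [mul_comm]
    rw [h7, h11] at h6
    refine le_of_mul_le_mul_left ?_ ht0
    rw [hs] at h6
    linarith
  have hlim : Tendsto (fun ε : ℝ => β * (ρ - α) + (‖v‖ * κ + β * L) * N +
      ε * (‖w‖ + κ * N + (|ρ - α| + L * N))) (𝓝[>] 0)
      (𝓝 (β * (ρ - α) + (‖v‖ * κ + β * L) * N +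
        0 * (‖w‖ + κ * N + (|ρ - α| + L * N)))) :=
    tendsto_const_nhds.add (hid.mul_const _)
  rw [zero_mul, add_zero] at hlim
  exact ge_of_tendsto hlim (eventually_mem_nhdsWithin.mono hε)

variable [FiniteDimensional ℝ F]

/-- The subdifferential chain rule: limiting subgradients of the composition have multipliers. -/
lemma IsFullySubamenableRep.exists_multiplier {φ : E → EReal} {x : E} {f : E → F} {ϑ : F → EReal}
    (h : IsFullySubamenableRep φ x f ϑ) {θ : ℝ} (hθ : φ x = θ) {v : E}
    (hv : v ∈ limitingSubdiff φ x) :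
    ∃ l : F, (∀ z, ⟪l, fderiv ℝ f x z⟫ = ⟪v, z⟫) ∧
      ∀ (p : F) (r : ℝ), ϑ p ≤ r → θ + ⟪l, p - f x⟫ ≤ r := by
  obtain ⟨κ, L, δ, hκ, hL, hδ, hcorr⟩ := h.exists_correction
  obtain ⟨-, -, -, xs, vs, hepi, hxs, hreg, hvs⟩ := hv
  rw [hθ, EReal.toReal_coe] at hxs
  let X : ℕ → E := fun k => (xs k).fst
  let α : ℕ → ℝ := fun k => (xs k).snd
  let V : ℕ → E := fun k => (vs k).fst
  let β : ℕ → ℝ := fun k => -(vs k).snd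
  have hX : Tendsto X atTop (𝓝 x) :=
    ((WithLp.continuous_fst 2 E ℝ).tendsto _).comp hxs
  have hα : Tendsto α atTop (𝓝 θ) :=
    ((WithLp.continuous_snd 2 E ℝ).tendsto _).comp hxs
  have hV : Tendsto V atTop (𝓝 v) :=
    ((WithLp.continuous_fst 2 E ℝ).tendsto _).comp hvs
  have hβ : Tendsto β atTop (𝓝 1) := by
    simpa using (((WithLp.continuous_snd 2 E ℝ).tendsto _).comp hvs).neg
  have hf : Tendsto (fun k => f (X k)) atTop (𝓝 (f x)) :=
    (h.twiceDiff.1.self_of_nhds.continuousAt.tendsto).comp hX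
  have hA : Tendsto (fun k => fderiv ℝ f (X k)) atTop (𝓝 (fderiv ℝ f x)) :=
    (h.twiceDiff.2.continuousAt.tendsto).comp hX
  have hbd : Tendsto (fun k => ‖V k‖ * κ + β k * L) atTop (𝓝 (‖v‖ * κ + 1 * L)) :=
    (hV.norm.mul_const κ).add (hβ.mul_const L)
  set B := ‖v‖ * κ + 1 * L + 1 with hB
  have hev : ∀ᶠ k in atTop, ∃ l ∈ Metric.closedBall (0 : F) B,
      (∀ z, ⟪l, fderiv ℝ f (X k) z⟫ = ⟪V k, z⟫) ∧
      ∀ (p : F) (r : ℝ), ϑ p ≤ r → ⟪l, p - f (X k)⟫ ≤ β k * (r - α k) := by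
    filter_upwards [hX.eventually_mem (Metric.ball_mem_nhds x hδ),
      hf.eventually_mem (Metric.ball_mem_nhds (f x) hδ), hX.eventually h.twiceDiff.1,
      hX.eventually h.eq_comp, hβ.eventually_const_lt one_pos,
      hbd.eventually_lt_const (lt_add_one _)] with k h1 h2 h3 h4 h5 h6
    have hαk : ϑ (f (X k)) ≤ α k := by
      rw [← h4]
      exact hepi k
    have hreg' : WithLp.toLp 2 (V k, -β k) ∈
        regularNormalCone (epigraph φ) (WithLp.toLp 2 (X k, α k)) := by
      simp only [V, β, X, α, neg_neg]
      exact hreg k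
    -- This is the epigraph of `ϑ`, recentred at `(f (X k), α k)` and scaled by `β k`, since the
    -- approximating normals are `(V k, -β k)` with `β k → 1`.
    let C : Set (F × ℝ) := {p | ∃ r : ℝ, ϑ (f (X k) + p.1) ≤ r ∧ β k * (r - α k) ≤ p.2}
    have hC : Convex ℝ C := by
      rintro p ⟨r, hr, hr'⟩ q ⟨s, hs, hs'⟩ a b ha hb hab
      refine ⟨a * r + b * s, ?_, ?_⟩
      · have := h.isConvex.combo hr hs ha hb hab
        convert this using 2
        simp only [Prod.fst_add, Prod.smul_fst, smul_add]
        nth_rw 1 [← one_smul ℝ (f (X k))]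
        rw [← hab, add_smul]
        abel
      · simp only [Prod.snd_add, Prod.smul_snd, smul_eq_mul]
        have e : β k * (a * r + b * s - α k) =
            a * (β k * (r - α k)) + b * (β k * (s - α k)) := by
          linear_combination (β k * α k) * hab
        rw [e]
        gcongr
    have h0 : ((0 : F), (0 : ℝ)) ∈ C := ⟨α k, by simpa using hαk, by simp⟩
    have hLk : 0 ≤ ‖V k‖ * κ + β k * L := by positivity
    obtain ⟨l, hl1, hl2⟩ := exists_multiplier_of_le_penalty hC ⟨_, h0⟩ (fderiv ℝ f (X k)) 0
      (V k) (G := 0) hLk (by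
        rintro z p ⟨r, hr, hr'⟩
        have := inner_le_penalty_of_mem_regularNormalCone h.isConvex hL hcorr h1 h2 h3 hαk
          hreg' z hr
        rw [add_sub_cancel_left] at this
        rw [add_zero]
        linarith)
    refine ⟨l, ?_, hl1, fun p r hp => ?_⟩
    -- Testing with `e = l` at the vertex gives `‖l‖² ≤ (‖V k‖ κ + β k L) ‖l‖`, the uniform bound
    -- needed for compactness.
    · have := hl2 _ h0 l
      simp only [zero_add, inner_zero_right, add_zero, real_inner_self_eq_norm_sq] at this
      rw [mem_closedBall_zero_iff]
      by_contra! hlt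
      nlinarith [norm_nonneg l]
    · have := hl2 (p - f (X k), β k * (r - α k)) ⟨r, by simpa using hp, le_rfl⟩ 0
      simpa using this
  obtain ⟨N, hN⟩ := eventually_atTop.1 hev
  choose l hlB hlA hlϑ using fun k => hN (k + N) (Nat.le_add_left N k)
  obtain ⟨l₀, -, ψ, hψ, hlim⟩ := tendsto_subseq_of_bounded Metric.isBounded_closedBall hlB
  have hσ : Tendsto (fun k => ψ k + N) atTop atTop :=
    tendsto_atTop_mono (fun k => Nat.le_add_right _ _) hψ.tendsto_atTop
  refine ⟨l₀, fun z => ?_, fun p r hp => ?_⟩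
  · have e1 : Tendsto (fun k => ⟪l (ψ k), fderiv ℝ f (X (ψ k + N)) z⟫) atTop
        (𝓝 ⟪l₀, fderiv ℝ f x z⟫) :=
      hlim.inner (((ContinuousLinearMap.apply ℝ F z).continuous.tendsto _).comp (hA.comp hσ))
    have e2 : Tendsto (fun k => ⟪V (ψ k + N), z⟫) atTop (𝓝 ⟪v, z⟫) :=
      (hV.comp hσ).inner tendsto_const_nhds
    simp only [hlA] at e1
    exact tendsto_nhds_unique e1 e2
  · have e1 : Tendsto (fun k => ⟪l (ψ k), p - f (X (ψ k + N))⟫) atTop (𝓝 ⟪l₀, p - f x⟫) :=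
      hlim.inner (tendsto_const_nhds.sub (hf.comp hσ))
    have e2 : Tendsto (fun k => β (ψ k + N) * (r - α (ψ k + N))) atTop (𝓝 (1 * (r - θ))) :=
      (hβ.comp hσ).mul (tendsto_const_nhds.sub (hα.comp hσ))
    have := le_of_tendsto_of_tendsto' e1 e2 fun k => hlϑ (ψ k) p r hp
    linarith

end FirstOrder

/-! ### Second-order lower estimate and penalty duality -/

section SecondOrder

variable {E F : Type*} [NormedAddCommGroup E] [InnerProductSpace ℝ E]
  [NormedAddCommGroup F] [InnerProductSpace ℝ F]

lemma tendsto_fst_nhds_zero {X : Type*} [TopologicalSpace X] (w : X) :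
    Tendsto (fun p : ℝ × X => p.1) (𝓝[>] (0 : ℝ) ×ˢ 𝓝 w) (𝓝 0) :=
  tendsto_fst.mono_right nhdsWithin_le_nhds

/-- The second-order Taylor quotients converge to the second derivative, jointly in the step and
the direction. -/
lemma TwiceDifferentiableAt.tendsto_quotient {f : E → F} {x : E} (hf : TwiceDifferentiableAt f x)
    (w : E) :
    Tendsto (fun p : ℝ × E =>
        (2 / p.1 ^ 2) • (f (x + p.1 • p.2) - f x - p.1 • fderiv ℝ f x p.2))
      (𝓝[>] (0 : ℝ) ×ˢ 𝓝 w) (𝓝 (secondDeriv f x w w)) := by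
  have hB : Tendsto (fun p : ℝ × E => secondDeriv f x p.2 p.2) (𝓝[>] (0 : ℝ) ×ˢ 𝓝 w)
      (𝓝 (secondDeriv f x w w)) := by
    have : Continuous fun z : E => secondDeriv f x z z := by
      unfold secondDeriv
      fun_prop
    exact (this.tendsto w).comp tendsto_snd
  suffices hdiff : Tendsto (fun p : ℝ × E =>
      (2 / p.1 ^ 2) • (f (x + p.1 • p.2) - f x - p.1 • fderiv ℝ f x p.2) -
        secondDeriv f x p.2 p.2) (𝓝[>] (0 : ℝ) ×ˢ 𝓝 w) (𝓝 0) by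
    simpa using hdiff.add hB
  rw [Metric.tendsto_nhds]
  intro ε hε
  have hsmul : Tendsto (fun p : ℝ × E => p.1 • p.2) (𝓝[>] (0 : ℝ) ×ˢ 𝓝 w) (𝓝 0) := by
    simpa using (tendsto_fst_nhds_zero w).smul (tendsto_snd (f := 𝓝[>] (0 : ℝ)) (g := 𝓝 w))
  set c := ε / (2 * (‖w‖ + 1) ^ 2 + 1) with hc
  have hcpos : 0 < c := by positivity
  have hnorm : ∀ᶠ p : ℝ × E in 𝓝[>] (0 : ℝ) ×ˢ 𝓝 w, ‖p.2‖ < ‖w‖ + 1 :=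
    (tendsto_snd (f := 𝓝[>] (0 : ℝ)) (g := 𝓝 w)).norm.eventually_lt_const (lt_add_one _)
  filter_upwards [hsmul.eventually (hf.taylor hcpos), hnorm, eventually_pos_fst w] with p h1 h2 h3
  obtain ⟨t, u⟩ := p
  simp only at h1 h2 h3 ⊢
  rw [dist_zero_right]
  have e : (2 / t ^ 2) • (f (x + t • u) - f x - t • fderiv ℝ f x u) - secondDeriv f x u u =
      (2 / t ^ 2) • (f (x + t • u) - f x - fderiv ℝ f x (t • u) -
        (1 / 2 : ℝ) • secondDeriv f x (t • u) (t • u)) := by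
    have e1 : secondDeriv f x (t • u) (t • u) = t ^ 2 • secondDeriv f x u u := by
      simp [secondDeriv, smul_smul, sq]
    rw [e1, map_smul, smul_sub _ _ ((1 / 2 : ℝ) • _), smul_smul, smul_smul]
    have e2 : 2 / t ^ 2 * (1 / 2 * t ^ 2) = 1 := by field_simp
    rw [mul_assoc] at *
    rw [e2, one_smul]
  rw [e, norm_smul, Real.norm_eq_abs, abs_of_pos (by positivity)]
  rw [norm_smul, Real.norm_eq_abs, abs_of_pos h3] at h1
  calc _ ≤ 2 / t ^ 2 * (c * (t * ‖u‖) ^ 2) := by gcongr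
    _ = c * (2 * ‖u‖ ^ 2) := by field_simp
    _ < c * (2 * (‖w‖ + 1) ^ 2 + 1) := by
        have : ‖u‖ ^ 2 ≤ (‖w‖ + 1) ^ 2 := by gcongr
        gcongr
        linarith
    _ = ε := by rw [hc, div_mul_cancel₀ _ (by positivity)]

/-- Every multiplier yields a lower estimate of the second subderivative of a composition. -/
lemma secondSubderiv_comp_ge {φ : E → EReal} {x v : E} {f : E → F} {ϑ : F → EReal} {θ : ℝ}
    (hθ : φ x = θ) (hcomp : ∀ᶠ u in 𝓝 x, φ u = ϑ (f u)) (hf : TwiceDifferentiableAt f x)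
    {l : F} (hl : ∀ z, ⟪l, fderiv ℝ f x z⟫ = ⟪v, z⟫) (w : E) :
    secondSubderiv ϑ (f x) l (fderiv ℝ f x w) + ((⟪l, secondDeriv f x w w⟫ : ℝ) : EReal) ≤
      secondSubderiv φ x v w := by
  have hθ' : ϑ (f x) = θ := by rw [← hcomp.self_of_nhds, hθ]
  have hρ := hf.tendsto_quotient w
  set ρ : ℝ × E → F := fun p =>
    (2 / p.1 ^ 2) • (f (x + p.1 • p.2) - f x - p.1 • fderiv ℝ f x p.2)
  set q := secondDeriv f x w w
  have hexp : ∀ p : ℝ × E, 0 < p.1 →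
      f (x + p.1 • p.2) = f x + p.1 • (fderiv ℝ f x p.2 + (p.1 / 2) • ρ p) := by
    rintro ⟨t, u⟩ ht
    simp only [ρ] at ht ⊢
    have e : t * (t / 2) * (2 / t ^ 2) = 1 := by field_simp
    rw [smul_add, smul_smul, smul_smul, e, one_smul]
    abel
  have hmap : Tendsto (fun p : ℝ × E => (p.1, fderiv ℝ f x p.2 + (p.1 / 2) • ρ p))
      (𝓝[>] (0 : ℝ) ×ˢ 𝓝 w) (𝓝[>] (0 : ℝ) ×ˢ 𝓝 (fderiv ℝ f x w)) := by
    refine tendsto_fst.prodMk ?_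
    have h1 := ((tendsto_fst_nhds_zero w).div_const 2).smul hρ
    have h2 := ((fderiv ℝ f x).continuous.tendsto w).comp
      (tendsto_snd (f := 𝓝[>] (0 : ℝ)) (g := 𝓝 w))
    simpa using h2.add h1
  have hinner : Tendsto (fun p => ⟪l, ρ p⟫) (𝓝[>] (0 : ℝ) ×ˢ 𝓝 w) (𝓝 ⟪l, q⟫) :=
    tendsto_const_nhds.inner hρ
  refine EReal.ge_of_forall_gt_iff_ge.1 fun a ha => ?_
  have ha' : ((a - ⟪l, q⟫ : ℝ) : EReal) < secondSubderiv ϑ (f x) l (fderiv ℝ f x w) := by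
    rw [EReal.coe_sub]
    exact EReal.sub_lt_of_lt_add ha
  obtain ⟨b, hab, hb⟩ := EReal.lt_iff_exists_real_btwn.1 ha'
  rw [EReal.coe_lt_coe_iff] at hab
  have hev := hmap.eventually (eventually_lt_of_lt_liminf hb (by isBoundedDefault))
  refine le_liminf_of_le (by isBoundedDefault) ?_
  filter_upwards [hev, hinner.eventually_const_lt (by linarith : a - b < ⟪l, q⟫),
    eventually_pos_fst w, (tendsto_add_smul x w).eventually hcomp] with p h1 h2 h3 h4
  refine le_of_lt ?_
  rw [lt_secondQuot_iff hθ h3, h4, hexp p h3]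
  rw [lt_secondQuot_iff hθ' h3] at h1
  refine lt_of_le_of_lt ?_ h1
  rw [EReal.coe_le_coe_iff, inner_add_right, hl, inner_smul_right]
  have : p.1 ^ 2 / 2 * (a - b) ≤ p.1 ^ 2 / 2 * ⟪l, ρ p⟫ := by gcongr
  linarith

/-- The asymptotic second-order epigraph of `ϑ` at `y` in the direction `u`: pairs `(h, R)` with
`ϑ (y + t u + t² h / 2) ≤ θ + t σ + t² R / 2 + o(t²)`. -/
def parabolicEpigraph (ϑ : F → EReal) (y u : F) (θ σ : ℝ) : Set (F × ℝ) :=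
  {p | ∀ ε > (0 : ℝ), ∀ᶠ t in 𝓝[>] (0 : ℝ),
    ϑ (y + t • u + (t ^ 2 / 2) • p.1) ≤ ((θ + t * σ + t ^ 2 / 2 * (p.2 + ε) : ℝ) : EReal)}

lemma IsConvexFun.convex_parabolicEpigraph {ϑ : F → EReal} (h : IsConvexFun ϑ) (y u : F)
    (θ σ : ℝ) : Convex ℝ (parabolicEpigraph ϑ y u θ σ) := by
  intro p hp q hq a b ha hb hab ε hε
  filter_upwards [hp ε hε, hq ε hε] with t h1 h2
  have h3 := h.combo h1 h2 ha hb hab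
  have hb' : b = 1 - a := by linarith
  subst hb'
  convert h3 using 2
  · simp only [Prod.fst_add, Prod.smul_fst]
    module
  · simp only [Prod.snd_add, Prod.smul_snd, smul_eq_mul]
    ring

/-- With `d = 1 - t² s / 2`, the parabolic point is the convex combination of `y + (t / d) u` and
`p` with weights `d` and `t² s / 2`, and the reparametrization `t / d` costs only `o(t²)`. Letting
`s` grow in these pairs is what makes the separating vector a subgradient. -/
lemma IsConvexFun.mem_parabolicEpigraph {ϑ : F → EReal} (h : IsConvexFun ϑ) {y u p : F}
    {θ σ c r s : ℝ}
    (hexp : ∀ᶠ t in 𝓝[>] (0 : ℝ), ϑ (y + t • u) = ((θ + t * σ + t ^ 2 / 2 * c : ℝ) : EReal))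
    (hp : ϑ p ≤ r) (hs : 0 ≤ s) :
    (s • (p - y), c + s * (r - θ)) ∈ parabolicEpigraph ϑ y u θ σ := by
  intro ε hε
  have hid : Tendsto (fun t : ℝ => t) (𝓝[>] 0) (𝓝 0) := nhdsWithin_le_nhds
  have hlam : Tendsto (fun t : ℝ => t ^ 2 / 2 * s) (𝓝[>] 0) (𝓝 0) := by
    simpa using ((hid.pow 2).div_const 2).mul_const s
  have hone : Tendsto (fun t : ℝ => 1 - t ^ 2 / 2 * s) (𝓝[>] 0) (𝓝 1) := by
    simpa using hlam.const_sub 1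
  have hpos : ∀ᶠ t in 𝓝[>] (0 : ℝ), 0 < 1 - t ^ 2 / 2 * s := hone.eventually_const_lt one_pos
  have hτ : Tendsto (fun t : ℝ => t / (1 - t ^ 2 / 2 * s)) (𝓝[>] 0) (𝓝[>] 0) := by
    have h0 := hid.div hone one_ne_zero
    rw [zero_div] at h0
    refine tendsto_nhdsWithin_iff.2 ⟨h0, ?_⟩
    filter_upwards [hpos, self_mem_nhdsWithin] with t h1 h2
    exact div_pos h2 h1
  have hc : Tendsto (fun t : ℝ => c / (1 - t ^ 2 / 2 * s)) (𝓝[>] 0) (𝓝 c) := by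
    have h0 := (tendsto_const_nhds (x := c)).div hone one_ne_zero
    rw [div_one] at h0
    exact h0
  filter_upwards [hpos, hτ.eventually hexp,
    hc.eventually_lt_const (lt_add_of_pos_right c hε)] with t h1 h2 h3
  have h4 := h.combo h2.le hp h1.le (by positivity : 0 ≤ t ^ 2 / 2 * s) (by ring)
  set d := 1 - t ^ 2 / 2 * s with hd
  have e : y + t • u + (t ^ 2 / 2) • s • (p - y) =
      d • (y + (t / d) • u) + (t ^ 2 / 2 * s) • p := by
    rw [smul_add, smul_smul d, mul_div_cancel₀ _ h1.ne', hd]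
    module
  rw [e]
  refine h4.trans ?_
  rw [EReal.coe_le_coe_iff]
  have e2 : d * (θ + t / d * σ + (t / d) ^ 2 / 2 * c) = d * θ + t * σ + t ^ 2 / 2 * (c / d) := by
    field_simp
  rw [e2]
  have h5 : t ^ 2 / 2 * (c / d) ≤ t ^ 2 / 2 * (c + ε) := by gcongr
  rw [hd]
  linarith

variable [FiniteDimensional ℝ F]

/-- Second-order exact penalty estimate for the difference quotients of a composition. -/
lemma IsFullySubamenableRep.eventually_exists_secondQuot_le {φ : E → EReal} {x : E} {f : E → F}
    {ϑ : F → EReal} (h : IsFullySubamenableRep φ x f ϑ) {θ : ℝ} (hθ : φ x = θ) (v : E) :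
    ∃ L : ℝ, 0 ≤ L ∧ ∀ w z : E,
      ∀ p ∈ parabolicEpigraph ϑ (f x) (fderiv ℝ f x w) θ ⟪v, w⟫, ∀ ε > (0 : ℝ),
      ∀ᶠ t in 𝓝[>] (0 : ℝ), ∃ w', ‖w' - w‖ < ε ∧ secondQuot φ x v t w' ≤
        ((p.2 - ⟪v, z⟫ + L * ‖fderiv ℝ f x z + secondDeriv f x w w - p.1‖ + ε : ℝ) : EReal) := by
  obtain ⟨κ, L, δ, hκ, hL, hδ, hcorr⟩ := h.exists_correction
  -- The correction costs `L` in the value of `φ` and `‖v‖ * κ` in the linear term `⟪v, ·⟫`, per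
  -- unit of residual.
  refine ⟨L + ‖v‖ * κ, by positivity, fun w z p hp ε hε => ?_⟩
  set A := fderiv ℝ f x with hA
  set q := secondDeriv f x w w with hq
  have hid : Tendsto (fun t : ℝ => t) (𝓝[>] 0) (𝓝 0) := nhdsWithin_le_nhds
  let n : ℝ → ℝ := fun t => ‖A z + (2 / t ^ 2) •
    (f (x + t • (w + (t / 2) • z)) - f x - t • A (w + (t / 2) • z)) - p.1‖
  have hn : Tendsto n (𝓝[>] 0) (𝓝 ‖A z + q - p.1‖) := by
    have h1 : Tendsto (fun t : ℝ => (t, w + (t / 2) • z)) (𝓝[>] 0) (𝓝[>] (0 : ℝ) ×ˢ 𝓝 w) := by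
      refine tendsto_id.prodMk ?_
      have := (((hid.div_const 2).smul_const z).const_add w)
      simpa using this
    have h2 := (h.twiceDiff.tendsto_quotient w).comp h1
    exact ((tendsto_const_nhds.add h2).sub tendsto_const_nhds).norm
  have hx1 : ∀ᶠ t in 𝓝[>] (0 : ℝ), x + t • (w + (t / 2) • z) ∈ Metric.ball x δ := by
    have : Continuous fun t : ℝ => x + t • (w + (t / 2) • z) := by fun_prop
    have h2 := (this.tendsto 0).mono_left (nhdsWithin_le_nhds (s := Set.Ioi 0))
    rw [zero_smul, add_zero] at h2
    exact h2.eventually_mem (Metric.ball_mem_nhds x hδ)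
  have hy1 : ∀ᶠ t in 𝓝[>] (0 : ℝ), f x + t • A w + (t ^ 2 / 2) • p.1 ∈ Metric.ball (f x) δ := by
    have : Continuous fun t : ℝ => f x + t • A w + (t ^ 2 / 2) • p.1 := by fun_prop
    have h2 := (this.tendsto 0).mono_left (nhdsWithin_le_nhds (s := Set.Ioi 0))
    simp only [zero_smul, add_zero, ne_eq, OfNat.ofNat_ne_zero, not_false_eq_true, zero_pow,
      zero_div] at h2
    exact h2.eventually_mem (Metric.ball_mem_nhds (f x) hδ)
  have hw : Tendsto (fun t => t / 2 * ‖z‖ + t / 2 * (κ * n t)) (𝓝[>] 0) (𝓝 0) := by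
    simpa using ((hid.div_const 2).mul_const ‖z‖).add ((hid.div_const 2).mul (hn.const_mul κ))
  have hval : Tendsto (fun t => (L + ‖v‖ * κ) * n t) (𝓝[>] 0)
      (𝓝 ((L + ‖v‖ * κ) * ‖A z + q - p.1‖)) := hn.const_mul _
  filter_upwards [hx1, hy1, hp (ε / 2) (by positivity), hw.eventually_lt_const hε,
    hval.eventually_lt_const (lt_add_of_pos_right _ (half_pos hε)), self_mem_nhdsWithin]
    with t h1 h2 h3 h4 h5 ht
  have ht : 0 < t := ht
  obtain ⟨u, hu, hφu⟩ := hcorr _ h1 _ h2 _ h3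
  have hη : ‖f (x + t • (w + (t / 2) • z)) - (f x + t • A w + (t ^ 2 / 2) • p.1)‖ =
      t ^ 2 / 2 * n t := by
    have e : t ^ 2 / 2 * (2 / t ^ 2) = 1 := by field_simp
    have : f (x + t • (w + (t / 2) • z)) - (f x + t • A w + (t ^ 2 / 2) • p.1) =
        (t ^ 2 / 2) • (A z + (2 / t ^ 2) •
          (f (x + t • (w + (t / 2) • z)) - f x - t • A (w + (t / 2) • z)) - p.1) := by
      rw [smul_sub, smul_add (t ^ 2 / 2), smul_smul (t ^ 2 / 2) (2 / t ^ 2), e, one_smul, map_add,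
        map_smul]
      module
    rw [this, norm_smul, Real.norm_eq_abs, abs_of_pos (by positivity)]
  rw [hη] at hu hφu
  have hut : x + t • (t⁻¹ • (u - x)) = u := by
    rw [smul_smul, mul_inv_cancel₀ ht.ne', one_smul, add_sub_cancel]
  refine ⟨t⁻¹ • (u - x), ?_, ?_⟩
  · have e : t⁻¹ • (u - x) - w = t⁻¹ • (u - (x + t • (w + (t / 2) • z))) + (t / 2) • z := by
      have e1 : t⁻¹ • (x + t • (w + (t / 2) • z)) = t⁻¹ • x + (w + (t / 2) • z) := by
        rw [smul_add, smul_smul, inv_mul_cancel₀ ht.ne', one_smul]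
      rw [smul_sub, smul_sub, e1]
      abel
    rw [e]
    refine lt_of_le_of_lt ((norm_add_le _ _).trans ?_) h4
    rw [norm_smul, norm_smul, Real.norm_eq_abs, Real.norm_eq_abs, abs_of_pos (inv_pos.2 ht),
      abs_of_pos (half_pos ht)]
    have := mul_le_mul_of_nonneg_left hu (inv_pos.2 ht).le
    have e2 : t⁻¹ * (κ * (t ^ 2 / 2 * n t)) = t / 2 * (κ * n t) := by field_simp
    linarith
  · rw [secondQuot_le_iff hθ ht, hut]
    refine hφu.trans ?_
    rw [EReal.coe_le_coe_iff]
    have e : t * ⟪v, t⁻¹ • (u - x)⟫ = ⟪v, u - x⟫ := by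
      rw [inner_smul_right, mul_inv_cancel_left₀ ht.ne']
    have e2 : ⟪v, u - x⟫ =
        ⟪v, u - (x + t • (w + (t / 2) • z))⟫ + (t * ⟪v, w⟫ + t ^ 2 / 2 * ⟪v, z⟫) := by
      have : u - x = u - (x + t • (w + (t / 2) • z)) + (t • w + (t ^ 2 / 2) • z) := by module
      rw [this, inner_add_right, inner_add_right, inner_smul_right, inner_smul_right]
    have h8 : -(‖v‖ * (κ * (t ^ 2 / 2 * n t))) ≤ ⟪v, u - (x + t • (w + (t / 2) • z))⟫ := by
      have h9 := abs_real_inner_le_norm v (u - (x + t • (w + (t / 2) • z)))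
      have h10 := mul_le_mul_of_nonneg_left hu (norm_nonneg v)
      linarith [neg_abs_le ⟪v, u - (x + t • (w + (t / 2) • z))⟫]
    rw [e, e2]
    have h11 := mul_le_mul_of_nonneg_left h5.le (by positivity : 0 ≤ t ^ 2 / 2)
    linarith

lemma secondSubderiv_le_of_eventually {φ : E → EReal} {x v w : E} {b : ℝ}
    (h : ∀ ε > (0 : ℝ), ∀ᶠ t in 𝓝[>] (0 : ℝ),
      ∃ w', ‖w' - w‖ < ε ∧ secondQuot φ x v t w' ≤ ((b + ε : ℝ) : EReal)) :
    secondSubderiv φ x v w ≤ b := by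
  refine EReal.ge_of_forall_gt_iff_ge.1 fun a ha => ?_
  have hev := eventually_lt_of_lt_liminf ha (by isBoundedDefault)
  obtain ⟨P, hP, Q, hQ, hPQ⟩ := eventually_prod_iff.1 hev
  obtain ⟨δ, hδ, hball⟩ := Metric.eventually_nhds_iff.1 hQ
  rw [EReal.coe_le_coe_iff]
  refine le_of_forall_pos_le_add fun ε hε => ?_
  obtain ⟨t, hPt, w', hw', hle⟩ := (hP.and (h (min δ ε) (lt_min hδ hε))).exists
  have h1 := hPQ hPt (hball (y := w') (by rw [dist_eq_norm]; exact hw'.trans_le (min_le_left _ _)))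
  have h2 := EReal.coe_lt_coe_iff.1 (h1.trans_le hle)
  linarith [min_le_right δ ε]

/-- In critical directions there is a multiplier whose lower estimate is approached by the
difference quotients of the composition. -/
lemma IsFullySubamenableRep.exists_multiplier_recovery {φ : E → EReal} {x : E} {f : E → F}
    {ϑ : F → EReal} (h : IsFullySubamenableRep φ x f ϑ) {θ : ℝ} (hθ : φ x = θ) {v w : E}
    {c m : ℝ}
    (hexp : ∀ᶠ t in 𝓝[>] (0 : ℝ), ϑ (f x + t • fderiv ℝ f x w) =
      ((θ + t * ⟪v, w⟫ + t ^ 2 / 2 * c : ℝ) : EReal))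
    (hm : (m : EReal) ≤ secondSubderiv φ x v w) :
    ∃ (G : ℝ) (l : F), (∀ z, ⟪l, fderiv ℝ f x z⟫ = ⟪v, z⟫) ∧
      (∀ (p : F) (r : ℝ), ϑ p ≤ r → θ + ⟪l, p - f x⟫ ≤ r) ∧
      G ≤ c + ⟪l, secondDeriv f x w w⟫ ∧
      ∀ ε > (0 : ℝ), ∀ᶠ t in 𝓝[>] (0 : ℝ),
        ∃ w', ‖w' - w‖ < ε ∧ secondQuot φ x v t w' ≤ ((G + ε : ℝ) : EReal) := by
  obtain ⟨L, hL, hquot⟩ := h.eventually_exists_secondQuot_le hθ v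
  have hθ' : ϑ (f x) = θ := by rw [← h.eq_comp.self_of_nhds, hθ]
  set A := fderiv ℝ f x with hA
  set q := secondDeriv f x w w with hq
  set C := parabolicEpigraph ϑ (f x) (A w) θ ⟪v, w⟫ with hC
  let val : E × (F × ℝ) → ℝ := fun y => y.2.2 - ⟪v, y.1⟫ + L * ‖A y.1 + q - y.2.1‖
  let S : Set ℝ := val '' (Set.univ ×ˢ C)
  have h0 : ((0 : F), c) ∈ C := by
    simpa using h.isConvex.mem_parabolicEpigraph hexp hθ'.le le_rfl
  have hSne : S.Nonempty := ⟨_, (0, (0, c)), ⟨trivial, h0⟩, rfl⟩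
  -- Every penalty value bounds the second subderivative from above, so the finite lower bound `m`
  -- is what keeps the infimum finite.
  have hSb : BddBelow S := by
    refine ⟨m, ?_⟩
    rintro _ ⟨⟨z, p⟩, ⟨-, hp⟩, rfl⟩
    exact EReal.coe_le_coe_iff.1
      (hm.trans (secondSubderiv_le_of_eventually fun ε hε => hquot w z p hp ε hε))
  set G := sInf S with hG
  have hGle : ∀ z, ∀ p ∈ C, G + ⟪v, z⟫ ≤ p.2 + L * ‖A z + q - p.1‖ := by
    intro z p hp
    have : G ≤ val (z, p) := csInf_le hSb ⟨(z, p), ⟨trivial, hp⟩, rfl⟩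
    simp only [val] at this
    linarith
  obtain ⟨l, hl1, hl2⟩ := exists_multiplier_of_le_penalty
    (h.isConvex.convex_parabolicEpigraph (f x) (A w) θ ⟪v, w⟫) ⟨_, h0⟩ A q v hL hGle
  refine ⟨G, l, hl1, fun p r hp => ?_, ?_, fun ε hε => ?_⟩
  · by_contra! hlt
    set d := θ + ⟪l, p - f x⟫ - r with hd
    have hdpos : 0 < d := by linarith
    -- A violation `d > 0` of the subgradient inequality is multiplied by `s` in the dual
    -- inequality; this `s` makes `s * d` exceed the available slack.
    have hs : 0 ≤ (|c + ⟪l, q⟫ - G| + 1) / d := by positivity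
    have h1 := hl2 _ (h.isConvex.mem_parabolicEpigraph hexp hp hs) 0
    simp only [add_zero, norm_zero, mul_zero, inner_smul_right] at h1
    have h2 : (|c + ⟪l, q⟫ - G| + 1) / d * d = |c + ⟪l, q⟫ - G| + 1 :=
      div_mul_cancel₀ _ hdpos.ne'
    have h3 := le_abs_self (c + ⟪l, q⟫ - G)
    have h4 : (|c + ⟪l, q⟫ - G| + 1) / d * d = (|c + ⟪l, q⟫ - G| + 1) / d * ⟪l, p - f x⟫ -
        (|c + ⟪l, q⟫ - G| + 1) / d * (r - θ) := by rw [← mul_sub]; congr 1; rw [hd]; ring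
    linarith
  · simpa using hl2 _ h0 0
  · obtain ⟨_, ⟨⟨z, p⟩, ⟨-, hp⟩, rfl⟩, hlt⟩ :=
      exists_lt_of_csInf_lt hSne (lt_add_of_pos_right G (half_pos hε))
    filter_upwards [hquot w z p hp (ε / 2) (half_pos hε)] with t ht
    obtain ⟨w', h1, h2⟩ := ht
    refine ⟨w', h1.trans (half_lt_self hε), h2.trans ?_⟩
    rw [EReal.coe_le_coe_iff]
    simp only [val] at hlt
    linarith

end SecondOrder

/-! ### Attainment, recovery sequences and the chain rule -/

section Main

variable {E F : Type*} [NormedAddCommGroup E] [InnerProductSpace ℝ E]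
  [NormedAddCommGroup F] [InnerProductSpace ℝ F]

/-- The subgradient inequality makes every quotient nonnegative; the bound `-1` leaves room for a
strict comparison. -/
lemma secondSubderiv_ne_bot {ϑ : F → EReal} {y l : F} {θ : ℝ} (hθ : ϑ y = θ)
    (hl : ∀ (p : F) (r : ℝ), ϑ p ≤ r → θ + ⟪l, p - y⟫ ≤ r) (u : F) :
    secondSubderiv ϑ y l u ≠ ⊥ := by
  have h : ((-1 : ℝ) : EReal) ≤ secondSubderiv ϑ y l u := by
    refine le_liminf_of_le (by isBoundedDefault) ?_
    filter_upwards [eventually_pos_fst u] with p hp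
    refine le_of_lt ?_
    rw [lt_secondQuot_iff hθ hp]
    by_contra! hle
    have := hl _ _ hle
    rw [add_sub_cancel_left, inner_smul_right] at this
    nlinarith [sq_pos_of_pos hp]
  exact ne_bot_of_le_ne_bot (EReal.coe_ne_bot _) h

/-- A diagonal choice of approximating directions along a sequence of steps. -/
lemma exists_seq_limsup_le {X : Type*} [NormedAddCommGroup X] {Q : ℝ → X → EReal} {w : X}
    {b : ℝ} (h : ∀ ε > (0 : ℝ), ∀ᶠ t in 𝓝[>] (0 : ℝ),
      ∃ w', ‖w' - w‖ < ε ∧ Q t w' ≤ ((b + ε : ℝ) : EReal))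
    {t : ℕ → ℝ} (ht : ∀ k, 0 < t k) (ht0 : Tendsto t atTop (𝓝 0)) :
    ∃ ws : ℕ → X, Tendsto ws atTop (𝓝 w) ∧ limsup (fun k => Q (t k) (ws k)) atTop ≤ b := by
  -- The tolerances achievable at step `t k`. A direction within `1 / (k + 1)` of the best tolerance
  -- works eventually for every fixed `ε`, so one sequence serves all of them.
  let S : ℕ → Set ℝ := fun k =>
    {ε | 0 < ε ∧ ∃ w', ‖w' - w‖ < ε ∧ Q (t k) w' ≤ ((b + ε : ℝ) : EReal)}
  have hchoose : ∀ k, ∃ w', ∀ ε ∈ S k, ∃ ε' < ε + 1 / ((k : ℝ) + 1), ‖w' - w‖ < ε' ∧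
      Q (t k) w' ≤ ((b + ε' : ℝ) : EReal) := by
    intro k
    rcases (S k).eq_empty_or_nonempty with he | hne
    · exact ⟨w, by simp [he]⟩
    · have hpos : 0 < 1 / ((k : ℝ) + 1) := by positivity
      obtain ⟨ε', ⟨-, w', h1, h2⟩, hlt⟩ :=
        exists_lt_of_csInf_lt hne (lt_add_of_pos_right (sInf (S k)) hpos)
      refine ⟨w', fun ε hε => ⟨ε', hlt.trans_le ?_, h1, h2⟩⟩
      have : sInf (S k) ≤ ε := csInf_le ⟨0, fun _ hy => hy.1.le⟩ hε
      linarith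
  choose ws hws using hchoose
  have hlim : Tendsto t atTop (𝓝[>] 0) :=
    tendsto_nhdsWithin_iff.2 ⟨ht0, Eventually.of_forall ht⟩
  have hev : ∀ ε > (0 : ℝ), ∀ᶠ k in atTop, ‖ws k - w‖ < ε ∧
      Q (t k) (ws k) ≤ ((b + ε : ℝ) : EReal) := by
    intro ε hε
    filter_upwards [hlim.eventually (h (ε / 2) (half_pos hε)),
      tendsto_one_div_add_atTop_nhds_zero_nat.eventually_lt_const (half_pos hε)] with k h1 h2
    obtain ⟨ε', h3, h4, h5⟩ := hws k (ε / 2) ⟨half_pos hε, h1⟩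
    have h6 : ε' < ε := by linarith
    refine ⟨h4.trans h6, h5.trans ?_⟩
    rw [EReal.coe_le_coe_iff]
    linarith
  refine ⟨ws, ?_, ?_⟩
  · rw [Metric.tendsto_nhds]
    intro ε hε
    simpa only [dist_eq_norm] using (hev ε hε).mono fun k hk => hk.1
  · refine EReal.le_of_forall_lt_iff_le.1 fun a ha => ?_
    rw [EReal.coe_lt_coe_iff] at ha
    refine limsup_le_of_le (by isBoundedDefault) ?_
    filter_upwards [hev (a - b) (by linarith)] with k hk
    simpa using hk.2

variable [FiniteDimensional ℝ E] [FiniteDimensional ℝ F]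

lemma mem_multiplierSet_iff {f : E → F} {ϑ : F → EReal} (hϑ : IsConvexFun ϑ) {x v : E} {θ : ℝ}
    (hθ : ϑ (f x) = θ) {l : F} :
    l ∈ multiplierSet f ϑ x v ↔ (∀ z, ⟪l, fderiv ℝ f x z⟫ = ⟪v, z⟫) ∧
      ∀ (p : F) (r : ℝ), ϑ p ≤ r → θ + ⟪l, p - f x⟫ ≤ r := by
  rw [← mem_limitingSubdiff_iff hϑ hθ]
  refine and_congr_left fun _ => ⟨?_, fun h => ?_⟩
  · rintro rfl z
    rw [ContinuousLinearMap.adjoint_inner_left]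
  · refine ext_inner_right ℝ fun z => ?_
    rw [ContinuousLinearMap.adjoint_inner_left, h]

/-- The maximum in the second-order chain rule is attained, and recovery sequences exist. -/
lemma IsFullySubamenableRep.exists_maximizer {φ : E → EReal} {x v : E} {f : E → F}
    {ϑ : F → EReal} (h : IsFullySubamenableRep φ x f ϑ) (hv : v ∈ limitingSubdiff φ x) (w : E) :
    (∃ l ∈ multiplierSet f ϑ x v, secondSubderiv ϑ (f x) l (fderiv ℝ f x w) +
      ((⟪l, secondDeriv f x w w⟫ : ℝ) : EReal) = secondSubderiv φ x v w) ∧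
    ∀ t : ℕ → ℝ, (∀ k, 0 < t k) → Tendsto t atTop (𝓝 0) →
      ∃ ws : ℕ → E, Tendsto ws atTop (𝓝 w) ∧
        limsup (fun k => secondQuot φ x v (t k) (ws k)) atTop ≤ secondSubderiv φ x v w := by
  obtain ⟨θ, hθ⟩ : ∃ θ : ℝ, φ x = θ := ⟨_, (EReal.coe_toReal hv.1 hv.2.1).symm⟩
  have hθ' : ϑ (f x) = θ := by rw [← h.eq_comp.self_of_nhds, hθ]
  obtain ⟨l₀, hl₀, hsub₀⟩ := h.exists_multiplier hθ hv
  have hlow : ∀ l, (∀ z, ⟪l, fderiv ℝ f x z⟫ = ⟪v, z⟫) →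
      secondSubderiv ϑ (f x) l (fderiv ℝ f x w) + ((⟪l, secondDeriv f x w w⟫ : ℝ) : EReal) ≤
        secondSubderiv φ x v w :=
    fun l hl => secondSubderiv_comp_ge hθ h.eq_comp h.twiceDiff hl w
  have hbot := secondSubderiv_ne_bot hθ' hsub₀ (fderiv ℝ f x w)
  have hlow₀ := hlow l₀ hl₀
  -- If the value at `l₀` is `⊤`, the lower estimate forces the second subderivative of `φ` to be
  -- `⊤`: `l₀` is a maximizer and constant sequences recover.
  rcases eq_or_ne (secondSubderiv ϑ (f x) l₀ (fderiv ℝ f x w)) ⊤ with htop | htop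
  · have hφ : secondSubderiv φ x v w = ⊤ := by
      rw [htop, EReal.top_add_coe, top_le_iff] at hlow₀
      exact hlow₀
    refine ⟨⟨l₀, (mem_multiplierSet_iff h.isConvex hθ').2 ⟨hl₀, hsub₀⟩, ?_⟩, fun t _ _ =>
      ⟨fun _ => w, tendsto_const_nhds, ?_⟩⟩
    · rw [htop, hφ, EReal.top_add_coe]
    · rw [hφ]
      exact le_top
  · lift secondSubderiv ϑ (f x) l₀ (fderiv ℝ f x w) to ℝ using ⟨htop, hbot⟩ with d hd
    obtain ⟨c, -, hexp⟩ := h.isPWLQ.expansion_of_secondSubderiv_lt hθ' hsub₀ (b := d + 1)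
      (by rw [← hd, EReal.coe_lt_coe_iff]; linarith)
    -- The slope becomes `⟪v, w⟫`, the same for every multiplier, so the expansion no longer refers
    -- to `l₀`.
    rw [hl₀] at hexp
    rw [← EReal.coe_add] at hlow₀
    obtain ⟨G, l, hl, hsub, hG, hrec⟩ := h.exists_multiplier_recovery hθ hexp hlow₀
    -- A smaller value at `l` would give a second expansion of `ϑ` along the same ray, with equal
    -- slope and a coefficient `c' < c`.
    have hc : (c : EReal) ≤ secondSubderiv ϑ (f x) l (fderiv ℝ f x w) := by
      by_contra! hlt
      obtain ⟨b, hb, hbc⟩ := EReal.lt_iff_exists_real_btwn.1 hlt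
      rw [EReal.coe_lt_coe_iff] at hbc
      obtain ⟨c', hc', hexp'⟩ := h.isPWLQ.expansion_of_secondSubderiv_lt hθ' hsub hb
      obtain ⟨t, ⟨h1, h2⟩, ht⟩ := ((hexp.and hexp').and self_mem_nhdsWithin).exists
      have ht : 0 < t := ht
      rw [h1, hl, EReal.coe_eq_coe_iff] at h2
      have h3 : t ^ 2 / 2 * (c - c') = 0 := by linarith
      have h4 : c - c' = 0 := (mul_eq_zero.1 h3).resolve_left (by positivity)
      linarith
    have hup := secondSubderiv_le_of_eventually hrec
    have hGle : (G : EReal) ≤ secondSubderiv ϑ (f x) l (fderiv ℝ f x w) +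
        ((⟪l, secondDeriv f x w w⟫ : ℝ) : EReal) :=
      (EReal.coe_le_coe_iff.2 hG).trans (by rw [EReal.coe_add]; gcongr)
    have hGeq : secondSubderiv φ x v w = G := le_antisymm hup (hGle.trans (hlow l hl))
    refine ⟨⟨l, (mem_multiplierSet_iff h.isConvex hθ').2 ⟨hl, hsub⟩,
      le_antisymm (hlow l hl) (hup.trans hGle)⟩, fun t ht ht0 => ?_⟩
    rw [hGeq]
    exact exists_seq_limsup_le hrec ht ht0

/-- The second-order chain rule for fully subamenable functions. -/
lemma IsFullySubamenableRep.isGreatest_secondSubderiv {φ : E → EReal} {x v : E} {f : E → F}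
    {ϑ : F → EReal} (h : IsFullySubamenableRep φ x f ϑ) (hv : v ∈ limitingSubdiff φ x) (w : E) :
    IsGreatest ((fun l : F => secondSubderiv ϑ (f x) l (fderiv ℝ f x w) +
      ((⟪l, secondDeriv f x w w⟫ : ℝ) : EReal)) '' multiplierSet f ϑ x v)
      (secondSubderiv φ x v w) := by
  refine ⟨(h.exists_maximizer hv w).1, ?_⟩
  obtain ⟨θ, hθ⟩ : ∃ θ : ℝ, φ x = θ := ⟨_, (EReal.coe_toReal hv.1 hv.2.1).symm⟩
  have hθ' : ϑ (f x) = θ := by rw [← h.eq_comp.self_of_nhds, hθ]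
  rintro _ ⟨l, hl, rfl⟩
  exact secondSubderiv_comp_ge hθ h.eq_comp h.twiceDiff
    ((mem_multiplierSet_iff h.isConvex hθ').1 hl).1 w

/-- The liminf half of epi-convergence is automatic, the second subderivative being a joint lower
limit. Properness follows from a maximizing multiplier, which excludes `⊥`, and from the zero
direction, where all quotients vanish. -/
lemma IsFullySubamenableRep.properlyTwiceEpiDifferentiableAt {φ : E → EReal} {x v : E} {f : E → F}
    {ϑ : F → EReal} (h : IsFullySubamenableRep φ x f ϑ) (hv : v ∈ limitingSubdiff φ x) :
    ProperlyTwiceEpiDifferentiableAt φ x v := by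
  obtain ⟨θ, hθ⟩ : ∃ θ : ℝ, φ x = θ := ⟨_, (EReal.coe_toReal hv.1 hv.2.1).symm⟩
  have hθ' : ϑ (f x) = θ := by rw [← h.eq_comp.self_of_nhds, hθ]
  refine ⟨fun t ht ht0 w => ⟨fun ws hws => ?_, (h.exists_maximizer hv w).2 t ht ht0⟩,
    fun w => ?_, 0, ?_⟩
  · have hlim : Tendsto (fun k => (t k, ws k)) atTop (𝓝[>] (0 : ℝ) ×ˢ 𝓝 w) :=
      (tendsto_nhdsWithin_iff.2 ⟨ht0, Eventually.of_forall ht⟩).prodMk hws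
    exact liminf_le_liminf_of_le hlim
  · obtain ⟨l, hl, heq⟩ := (h.exists_maximizer hv w).1
    rw [← heq, Ne, EReal.add_eq_bot_iff, not_or]
    exact ⟨secondSubderiv_ne_bot hθ' ((mem_multiplierSet_iff h.isConvex hθ').1 hl).2 _,
      EReal.coe_ne_bot _⟩
  · have : secondSubderiv φ x v 0 ≤ ((0 : ℝ) : EReal) := by
      refine secondSubderiv_le_of_eventually fun ε hε => ?_
      filter_upwards [self_mem_nhdsWithin] with t ht
      have ht : 0 < t := ht
      refine ⟨0, by simpa using hε, ?_⟩
      rw [secondQuot_le_iff hθ ht, smul_zero, add_zero, hθ, EReal.coe_le_coe_iff]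
      have : 0 ≤ t ^ 2 / 2 * ε := by positivity
      simpa using this
    exact this.trans_lt (EReal.coe_lt_top 0)

end Main

end VarAnalysis

/-- The second part covers every fully subamenable representation of `φ`; the maximum is taken in
`[-∞, ∞]` and is attained (possibly with the value `∞`). -/
theorem theorem5p2 {n : ℕ} (φ : EuclideanSpace ℝ (Fin n) → EReal) (hφ : ∀ u, φ u ≠ ⊥)
    (x : EuclideanSpace ℝ (Fin n)) (hx : VarAnalysis.FullySubamenableAt φ x) :
    (∀ v ∈ VarAnalysis.limitingSubdiff φ x,
      VarAnalysis.ProperlyTwiceEpiDifferentiableAt φ x v) ∧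
    ∀ (m : ℕ) (f : EuclideanSpace ℝ (Fin n) → EuclideanSpace ℝ (Fin m))
      (ϑ : EuclideanSpace ℝ (Fin m) → EReal),
      VarAnalysis.IsFullySubamenableRep φ x f ϑ →
      ∀ v ∈ VarAnalysis.limitingSubdiff φ x, ∀ w : EuclideanSpace ℝ (Fin n),
        IsGreatest
          ((fun l : EuclideanSpace ℝ (Fin m) =>
              VarAnalysis.secondSubderiv ϑ (f x) l (fderiv ℝ f x w) +
                ((⟪l, VarAnalysis.secondDeriv f x w w⟫ : ℝ) : EReal)) ''
            VarAnalysis.multiplierSet f ϑ x v)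
          (VarAnalysis.secondSubderiv φ x v w) := by
  obtain ⟨m₀, f₀, ϑ₀, h₀⟩ := hx
  exact ⟨fun v hv => h₀.properlyTwiceEpiDifferentiableAt hv,
    fun m f ϑ h v hv w => h.isGreatest_secondSubderiv hv w⟩
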